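/- Let $d\ge 1$, let $\Omega\subset\mathbb R^d$ be an open set, and put $p^*=\frac{d+2}{d-2}$ if $d\ge 3$ and $p^*=\infty$ if $d=1,2$. Let $L$ be a self-adjoint operator with domain $\mathcal D(L)$ on the complex Hilbert space $L^2(\Omega)$. Consider the following assumptions. **Assumption A.** For every $2\le q<p^*+1$ there are constants $C>0$ and $0\le\omega<1$ such that $e^{-tL}$ is bounded from $L^2(\Omega)$ to $L^q(\Omega)$ with $$\|e^{-tL}\|_{L^2(\Omega)\to L^q(\Omega)}\le C\,t^{-\frac d2\left(\frac12-\frac1q\right)}e^{\omega t}\qquad\text{for all }t>0.$$ **Assumption B.** $L$ is non-negative, and $e^{-tL}$ ($t>0$) has an integral kernel $K_L(t;x,y)$ for which there are constants $c,C>0$ with $$|K_L(t;x,y)|\le C\,t^{-\frac d2}e^{-\frac{|x-y|^2}{ct}}\qquad\text{for all }t>0\text{ and almost all }x,y\in\Omega.$$ Under Assumption A let $\mathcal X(L)$ be the space of all $f\in L^1(\Omega)\cap\mathcal D(L)$ with $L^Mf\in L^1(\Omega)\cap\mathcal D(L)$ for all $M\in\mathbb N$; under Assumption B let $\mathcal Z(L)$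 be the space of all such $f$ with $L^Mf\in L^1(\Omega)\cap\mathcal D(L)$ for all $M\in\mathbb Z$. Give them the topologies of the seminorms $\|L^Mf\|_{L^1}+\|L^Mf\|_{L^2}$, and let $\mathcal X'(L)$, $\mathcal Z'(L)$ be the spaces of continuous conjugate-linear functionals on them. A function $u$ is identified with the functional $g\mapsto\int_\Omega u\,\overline g\,dx$. Put $$H^1(L)=\{f\in\mathcal X'(L):(I+L)^{1/2}f\in L^2(\Omega)\},\qquad \|f\|_{H^1(L)}=\|(I+L)^{1/2}f\|_{L^2(\Omega)},$$ $$\dot H^1(L)=\{f\in\mathcal Z'(L):L^{1/2}f\in L^2(\Omega)\},\qquad \|f\|_{\dot H^1(L)}=\|L^{1/2}f\|_{L^2(\Omega)}.$$ Here, for $B=(I+L)^{1/2}$ or $B=L^{1/2}$ and $h\in L^2(\Omega)$, the equation $Bf=h$ is understood by duality: $\langle f,Bw\rangle=\int_\Omega h\,\overline w\,dx$ for all $w\in\mathcal D(B)$ such that $Bw$ is in $\mathcal X(L)$, respectively $\mathcal Z(L)$. Then the following hold. (i) Suppose that $L$ satisfies Assumption A. Then for every $1<p<p^*$ there is a constant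 $C>0$ such that every $f\in H^1(L)$ is given by a function in $L^{p+1}(\Omega)$ with $$\|f\|_{L^{p+1}(\Omega)}\le C\|f\|_{H^1(L)}.$$ The same inequality holds, with the same $C$, for every function $f\in L^2(\Omega)$ in the domain of $(I+L)^{1/2}$. (ii) Suppose that $d\ge3$ and that $L$ satisfies Assumption B. Then there is a constant $C>0$ such that every $f\in\dot H^1(L)$ is given by a function in $L^{\frac{2d}{d-2}}(\Omega)$ with $$\|f\|_{L^{\frac{2d}{d-2}}(\Omega)}\le C\|f\|_{\dot H^1(L)}.$$ The same inequality holds, with the same $C$, for every function $f\in L^2(\Omega)$ in the domain of $L^{1/2}$. -/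

import Mathlib

open MeasureTheory Filter Topology
open scoped ENNReal ComplexConjugate

noncomputable section

/-! ### Functions of a self-adjoint operator -/

namespace OpCalc

variable {H : Type*} [NormedAddCommGroup H] [InnerProductSpace ℂ H] [CompleteSpace H]

/-- `R = (L + i)⁻¹`: a bounded operator with values in the domain of `L` and with
`L (R f) + i R f = f` for all `f`. -/
def IsResolvent (L : H →ₗ.[ℂ] H) (R : H →L[ℂ] H) : Prop :=
  ∀ f : H, (R f, f - Complex.I • R f) ∈ L.graph

open Classical in
/-- The resolvent `(L + i)⁻¹`; it exists whenever `L` is self-adjoint, see `resolvent_spec`. -/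
def resolvent (L : H →ₗ.[ℂ] H) : H →L[ℂ] H :=
  if h : ∃ R, IsResolvent L R then h.choose else 0

theorem norm_sq_of_selfAdjoint {L : H →ₗ.[ℂ] H} (hL : IsSelfAdjoint L) (x : L.domain) :
    ‖L x + Complex.I • (x : H)‖ ^ 2 = ‖L x‖ ^ 2 + ‖(x : H)‖ ^ 2 := by
  have hd := hL.dense_domain
  have hf : L.IsFormalAdjoint L := by
    have := LinearPMap.adjoint_isFormalAdjoint hd
    rwa [LinearPMap.isSelfAdjoint_def.mp hL] at this
  have him : (inner ℂ (L x) (x : H)).im = 0 := by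
    have h1 : inner ℂ (L x) (x : H) = inner ℂ (x : H) (L x) := hf x x
    have h2 := congrArg Complex.im (inner_conj_symm (𝕜 := ℂ) (L x) (x : H))
    rw [← h1] at h2
    simp only [Complex.conj_im] at h2
    linarith
  rw [norm_add_sq (𝕜 := ℂ), inner_smul_right, norm_smul]
  simp [him]

theorem exists_isResolvent {L : H →ₗ.[ℂ] H} (hL : IsSelfAdjoint L) :
    ∃ R, IsResolvent L R := by
  have hd := hL.dense_domain
  have hn := norm_sq_of_selfAdjoint hL
  set T : L.domain →ₗ[ℂ] H := L.toFun + Complex.I • L.domain.subtype with hT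
  have hTx : ∀ x : L.domain, T x = L x + Complex.I • (x : H) := fun x => rfl
  have hle : ∀ x : L.domain, ‖(x : H)‖ ≤ ‖T x‖ := fun x => by
    have := hn x
    rw [hTx]
    exact abs_le_of_sq_le_sq' (by nlinarith [sq_nonneg ‖L x‖]) (norm_nonneg _) |>.2
  -- the range is dense
  have hperp : (LinearMap.range T)ᗮ = ⊥ := by
    rw [Submodule.eq_bot_iff]
    intro y hy
    have h0 : ∀ x : L.domain, inner ℂ (Complex.I • y) (x : H) = inner ℂ y (L x) := by
      intro x
      have h1 : inner ℂ (T x) y = 0 := hy _ ⟨x, rfl⟩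
      have h2 : inner ℂ y (T x) = 0 := inner_eq_zero_symm.mp h1
      rw [hTx, inner_add_right, inner_smul_right] at h2
      rw [inner_smul_left, Complex.conj_I]
      linear_combination -h2
    have hyd : y ∈ (LinearPMap.adjoint L).domain :=
      LinearPMap.mem_adjoint_domain_of_exists y ⟨_, h0⟩
    have hap : LinearPMap.adjoint L ⟨y, hyd⟩ = Complex.I • y :=
      LinearPMap.adjoint_apply_eq hd ⟨y, hyd⟩ h0
    have hg : (y, Complex.I • y) ∈ L.graph := by
      have hg' : (y, Complex.I • y) ∈ (LinearPMap.adjoint L).graph := by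
        rw [LinearPMap.mem_graph_iff]
        exact ⟨⟨y, hyd⟩, rfl, hap⟩
      rwa [LinearPMap.isSelfAdjoint_def.mp hL] at hg'
    obtain ⟨z, hz1, hz2⟩ := (LinearPMap.mem_graph_iff L).mp hg
    simp only at hz1 hz2
    have h3 := h0 z
    rw [hz1, hz2, inner_smul_left, inner_smul_right, Complex.conj_I] at h3
    have h4 : (2 * Complex.I) * inner ℂ y y = 0 := by linear_combination -h3
    have h5 : inner ℂ y y = 0 := by simpa using h4
    exact inner_self_eq_zero.mp h5
  -- the range is closed
  have hcl : IsClosed (LinearMap.range T : Set H) := by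
    rw [← isSeqClosed_iff_isClosed]
    intro u f hu huf
    choose x hx using hu
    have hc : CauchySeq fun n => (x n : H) := by
      have hcu := huf.cauchySeq
      rw [Metric.cauchySeq_iff] at hcu ⊢
      intro ε hε
      obtain ⟨N, hN⟩ := hcu ε hε
      refine ⟨N, fun m hm n hn => lt_of_le_of_lt ?_ (hN m hm n hn)⟩
      rw [dist_eq_norm, dist_eq_norm, ← hx m, ← hx n, ← map_sub]
      exact hle (x m - x n)
    obtain ⟨y, hy⟩ := cauchySeq_tendsto_of_complete hc
    have hLx : Tendsto (fun n => L (x n)) atTop (𝓝 (f - Complex.I • y)) := by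
      have : (fun n => L (x n)) = fun n => u n - Complex.I • (x n : H) := by
        funext n
        rw [← hx n, hTx]
        simp
      rw [this]
      exact huf.sub (hy.const_smul _)
    have hgc : IsClosed (L.graph : Set (H × H)) := hL.isClosed
    have hmem : (y, f - Complex.I • y) ∈ L.graph :=
      hgc.mem_of_tendsto (hy.prodMk_nhds hLx)
        (Eventually.of_forall fun n => LinearPMap.mem_graph L (x n))
    obtain ⟨z, hz1, hz2⟩ := (LinearPMap.mem_graph_iff L).mp hmem
    simp only at hz1 hz2
    refine ⟨z, ?_⟩
    rw [hTx, hz1, hz2]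
    simp
  have hrange : LinearMap.range T = ⊤ := by
    have h1 := (LinearMap.range T).topologicalClosure_eq_top_iff.mpr hperp
    rwa [hcl.submodule_topologicalClosure_eq] at h1
  have hinj : Function.Injective T := by
    rw [injective_iff_map_eq_zero]
    intro x hx
    have := hle x
    rw [hx, norm_zero] at this
    exact Subtype.ext (norm_le_zero_iff.mp this)
  set e := LinearEquiv.ofBijective T ⟨hinj, LinearMap.range_eq_top.mp hrange⟩
  have he : ∀ f, T (e.symm f) = f := fun f => e.apply_symm_apply f
  refine ⟨LinearMap.mkContinuous (L.domain.subtype ∘ₗ e.symm.toLinearMap) 1 fun f => ?_,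
    fun f => ?_⟩
  · have := hle (e.symm f)
    rw [he] at this
    simpa using this
  · rw [LinearPMap.mem_graph_iff]
    refine ⟨e.symm f, rfl, ?_⟩
    have := he f
    rw [hTx] at this
    exact eq_sub_of_add_eq this

theorem resolvent_spec {L : H →ₗ.[ℂ] H} (hL : IsSelfAdjoint L) : IsResolvent L (resolvent L) := by
  have h := exists_isResolvent hL
  rw [resolvent, dif_pos h]
  exact h.choose_spec

/-- `ψ(L)` for a continuous compactly supported `ψ : ℝ → ℝ` and a self-adjoint `L`: the continuous
functional calculus of the bounded normal operator `R = (L + i)⁻¹`. The point `r ≠ 0` of the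
spectrum of `R` corresponds to the point `λ = r⁻¹ - i = re (r⁻¹)` of the spectrum of `L`, and
`r = 0` to `λ = ∞`. -/
def compactCalc (L : H →ₗ.[ℂ] H) (ψ : ℝ → ℝ) : H →L[ℂ] H :=
  cfc (fun r : ℂ => if r = 0 then 0 else ((ψ (r⁻¹).re : ℝ) : ℂ)) (resolvent L)

/-- The continuous cutoff equal to `1 - |x| / (n + 1)` on `[-(n + 1), n + 1]` and `0` outside;
it increases to `1` as `n → ∞`. -/
def cutoff (n : ℕ) (x : ℝ) : ℝ := max 0 (1 - |x| / (n + 1))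

/-- `φ(L)` for a self-adjoint `L` and a continuous `φ : ℝ → ℝ`, as an operator with domain:
`f` is in the domain if and only if `φ ∈ L²(μ_f)`, `μ_f` the spectral measure of `L` at `f`, if and
only if the `(φ χₙ)(L) f` converge, and then `φ(L) f` is their limit. -/
def funCalc (L : H →ₗ.[ℂ] H) (φ : ℝ → ℝ) : H →ₗ.[ℂ] H where
  domain :=
    { carrier := {f | ∃ g, Tendsto
        (fun n => compactCalc L (fun x => φ x * cutoff n x) f) atTop (𝓝 g)}
      zero_mem' := ⟨0, by simp⟩
      add_mem' := by
        rintro f₁ f₂ ⟨g₁, h₁⟩ ⟨g₂, h₂⟩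
        exact ⟨g₁ + g₂, by simpa only [map_add] using h₁.add h₂⟩
      smul_mem' := by
        rintro c f ⟨g, h⟩
        exact ⟨c • g, by simpa only [map_smul] using h.const_smul c⟩ }
  toFun :=
    { toFun := fun f => f.2.choose
      map_add' := fun f₁ f₂ => tendsto_nhds_unique (f₁ + f₂).2.choose_spec
        (by simpa only [map_add, Submodule.coe_add] using
          f₁.2.choose_spec.add f₂.2.choose_spec)
      map_smul' := fun c f => tendsto_nhds_unique (c • f).2.choose_spec
        (by simpa only [map_smul, Submodule.coe_smul, RingHom.id_apply] using
          f.2.choose_spec.const_smul c) }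

theorem mem_graph_funCalc_iff {L : H →ₗ.[ℂ] H} {φ : ℝ → ℝ} {f g : H} :
    (f, g) ∈ (funCalc L φ).graph ↔
      Tendsto (fun n => compactCalc L (fun x => φ x * cutoff n x) f) atTop (𝓝 g) := by
  rw [LinearPMap.mem_graph_iff]
  constructor
  · rintro ⟨y, rfl, rfl⟩
    exact y.2.choose_spec
  · intro h
    exact ⟨⟨f, g, h⟩, rfl, tendsto_nhds_unique
      (Exists.choose_spec (p := fun g => Tendsto
        (fun n => compactCalc L (fun x => φ x * cutoff n x) f) atTop (𝓝 g)) ⟨g, h⟩) h⟩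

/-- `e^{-tL}`. -/
def expNeg (L : H →ₗ.[ℂ] H) (t : ℝ) : H →ₗ.[ℂ] H := funCalc L fun x => Real.exp (-t * x)

/-- `(I + L)^{1/2}`, for self-adjoint `L` with `I + L ≥ 0`. -/
def sqrtOneAdd (L : H →ₗ.[ℂ] H) : H →ₗ.[ℂ] H := funCalc L fun x => Real.sqrt (1 + x)

/-- `L^{1/2}`, for self-adjoint `L ≥ 0`. -/
def sqrtOp (L : H →ₗ.[ℂ] H) : H →ₗ.[ℂ] H := funCalc L fun x => Real.sqrt x

end OpCalc

/-! ### The assumptions on the operator -/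

namespace SobolevOp

open OpCalc

variable {d : ℕ}

/-- The complex Hilbert space `L²(Ω)`. -/
abbrev L2 (Ω : Set (EuclideanSpace ℝ (Fin d))) : Type := Lp ℂ 2 (volume.restrict Ω)

/-- The critical exponent: `(d + 2) / (d - 2)` if `d ≥ 3`, and `∞` if `d = 1, 2`. -/
def pStar (d : ℕ) : EReal := if 3 ≤ d then ((((d : ℝ) + 2) / ((d : ℝ) - 2) : ℝ) : EReal) else ⊤

variable {Ω : Set (EuclideanSpace ℝ (Fin d))}

/-- `L` is self-adjoint, and for any `2 ≤ q < p* + 1` there are `C > 0` and `0 ≤ ω < 1` such that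
for all `t > 0` the operator `e^{-tL}` is defined on all of `L²(Ω)`, and is bounded from `L²(Ω)` to
`L^q(Ω)` with norm at most `C t^{-(d/2)(1/2 - 1/q)} e^{ωt}`. -/
def AssumptionA (L : L2 Ω →ₗ.[ℂ] L2 Ω) : Prop :=
  IsSelfAdjoint L ∧
  ∀ q : ℝ, 2 ≤ q → (q : EReal) < pStar d + 1 →
    ∃ C ω : ℝ, 0 < C ∧ 0 ≤ ω ∧ ω < 1 ∧ ∀ t : ℝ, 0 < t → ∀ f : L2 Ω,
      ∃ g : L2 Ω, (f, g) ∈ (expNeg L t).graph ∧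
        eLpNorm g (ENNReal.ofReal q) (volume.restrict Ω) ≤
          ENNReal.ofReal
            (C * t ^ (-((d : ℝ) / 2 * (1 / 2 - 1 / q))) * Real.exp (ω * t) * ‖f‖)

/-- `L` is self-adjoint and non-negative, and `e^{-tL}`, `t > 0`, is an integral operator whose
kernel `K t x y` satisfies `|K t x y| ≤ C t^{-d/2} exp(-|x - y|² / (c t))` for almost all `x, y`. -/
def AssumptionB (L : L2 Ω →ₗ.[ℂ] L2 Ω) : Prop :=
  IsSelfAdjoint L ∧ (∀ f : L.domain, 0 ≤ (inner ℂ (L f) (f : L2 Ω)).re) ∧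
  ∃ c C : ℝ, 0 < c ∧ 0 < C ∧
    ∃ K : ℝ → EuclideanSpace ℝ (Fin d) → EuclideanSpace ℝ (Fin d) → ℂ, ∀ t : ℝ, 0 < t →
      AEStronglyMeasurable (Function.uncurry (K t))
        ((volume.restrict Ω).prod (volume.restrict Ω)) ∧
      (∀ᵐ z ∂((volume.restrict Ω).prod (volume.restrict Ω)),
        ‖K t z.1 z.2‖ ≤
          C * t ^ (-((d : ℝ) / 2)) * Real.exp (-(‖z.1 - z.2‖ ^ 2 / (c * t)))) ∧
      ∀ f : L2 Ω, ∃ g : L2 Ω, (f, g) ∈ (expNeg L t).graph ∧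
        ∀ᵐ x ∂(volume.restrict Ω), g x = ∫ y in Ω, K t x y * f y

/-! ### Test functions, distributions and Sobolev spaces -/

section Test

variable (ι : Type) [AddZeroClass ι] [One ι]

/-- `u k = L^k (u 0)` for all `k`, where each `u k` is in `L¹(Ω)` and in the domain of `L`. -/
def IsPowers {ι : Type} [AddZeroClass ι] [One ι] (L : L2 Ω →ₗ.[ℂ] L2 Ω) (u : ι → L2 Ω) : Prop :=
  ∀ k, Integrable (u k) (volume.restrict Ω) ∧ (u k, u (k + 1)) ∈ L.graph

/-- The test functions: `f ∈ L¹(Ω) ∩ D(L)` with `L^M f ∈ L¹(Ω) ∩ D(L)` for all `M` in the index set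
`ι`. This is `𝒳(L)` for `ι = ℕ`, and `𝒵(L)` for `ι = ℤ` (where `L` is injective). -/
def testSpace (L : L2 Ω →ₗ.[ℂ] L2 Ω) : Submodule ℂ (L2 Ω) where
  carrier := {f | ∃ u : ι → L2 Ω, u 0 = f ∧ IsPowers L u}
  zero_mem' := ⟨0, rfl, fun k => ⟨by
    have := Lp.coeFn_zero ℂ 2 (volume.restrict Ω)
    exact (integrable_congr this).mpr (integrable_zero _ _ _), L.graph.zero_mem⟩⟩
  add_mem' := by
    rintro _ _ ⟨u, rfl, hu⟩ ⟨v, rfl, hv⟩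
    exact ⟨u + v, rfl, fun k =>
      ⟨(integrable_congr (Lp.coeFn_add (u k) (v k))).mpr ((hu k).1.add (hv k).1),
        L.graph.add_mem (hu k).2 (hv k).2⟩⟩
  smul_mem' := by
    rintro c _ ⟨u, rfl, hu⟩
    exact ⟨c • u, rfl, fun k =>
      ⟨(integrable_congr (Lp.coeFn_smul c (u k))).mpr ((hu k).1.smul c),
        L.graph.smul_mem c (hu k).2⟩⟩

variable {ι}

/-- Continuity of a conjugate-linear functional on the test space, for the locally convex topology
of the seminorms `‖L^M g‖_{L¹} + ‖L^M g‖_{L²}`, `M ∈ ι`. -/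
def IsContinuousDual (L : L2 Ω →ₗ.[ℂ] L2 Ω)
    (F : testSpace ι L →ₛₗ[starRingEnd ℂ] ℂ) : Prop :=
  ∃ (s : Finset ι) (C : ℝ), ∀ (g : testSpace ι L) (u : ι → L2 Ω),
    u 0 = g → IsPowers L u →
      ‖F g‖ ≤ C * ∑ k ∈ s, ((∫ x in Ω, ‖u k x‖) + ‖u k‖)

/-- `B F = h ∈ L²(Ω)` for a functional `F` on the test space and a self-adjoint `B`, by duality:
`⟨F, B w⟩ = ⟨h, w⟩` for all `w` in the domain of `B` for which `B w` is a test function. -/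
def DualEq {L : L2 Ω →ₗ.[ℂ] L2 Ω} (B : L2 Ω →ₗ.[ℂ] L2 Ω)
    (F : testSpace ι L →ₛₗ[starRingEnd ℂ] ℂ) (h : L2 Ω) : Prop :=
  ∀ (w : L2 Ω) (g : testSpace ι L), (w, (g : L2 Ω)) ∈ B.graph →
    F g = ∫ x in Ω, h x * conj (w x)

/-- The functional `F` is (given by) the function `u`: `⟨F, g⟩ = ∫_Ω u ḡ` for all test `g`. -/
def IsFunction {L : L2 Ω →ₗ.[ℂ] L2 Ω} (F : testSpace ι L →ₛₗ[starRingEnd ℂ] ℂ)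
    (u : EuclideanSpace ℝ (Fin d) → ℂ) : Prop :=
  ∀ g : testSpace ι L, Integrable (fun x => u x * conj ((g : L2 Ω) x)) (volume.restrict Ω) ∧
    F g = ∫ x in Ω, u x * conj ((g : L2 Ω) x)

end Test

/-- `F ∈ 𝒳'(L)` is in `H¹(L)`, with `(I + L)^{1/2} F = h ∈ L²(Ω)`, so `‖F‖_{H¹(L)} = ‖h‖_{L²}`. -/
def MemH1 (L : L2 Ω →ₗ.[ℂ] L2 Ω) (F : testSpace ℕ L →ₛₗ[starRingEnd ℂ] ℂ) (h : L2 Ω) : Prop :=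
  IsContinuousDual L F ∧ DualEq (sqrtOneAdd L) F h

/-- `F ∈ 𝒵'(L)` is in `Ḣ¹(L)`, with `L^{1/2} F = h ∈ L²(Ω)`, so `‖F‖_{Ḣ¹(L)} = ‖h‖_{L²}`. -/
def MemHomH1 (L : L2 Ω →ₗ.[ℂ] L2 Ω) (F : testSpace ℤ L →ₛₗ[starRingEnd ℂ] ℂ) (h : L2 Ω) : Prop :=
  IsContinuousDual L F ∧ DualEq (sqrtOp L) F h

end SobolevOp

end

set_option linter.unusedSectionVars false

noncomputable section

namespace OpCalc

variable {H : Type*} [NormedAddCommGroup H] [InnerProductSpace ℂ H] [CompleteSpace H]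

/-! ### The resolvent is normal -/

theorem inner_apply_of_mem_graph {L : H →ₗ.[ℂ] H} (hL : IsSelfAdjoint L) {x x' y y' : H}
    (hx : (x, x') ∈ L.graph) (hy : (y, y') ∈ L.graph) : inner ℂ x' y = inner ℂ x y' := by
  have hf : L.IsFormalAdjoint L := by
    have := LinearPMap.adjoint_isFormalAdjoint hL.dense_domain
    rwa [LinearPMap.isSelfAdjoint_def.mp hL] at this
  obtain ⟨a, rfl, rfl⟩ := (LinearPMap.mem_graph_iff L).mp hx
  obtain ⟨b, rfl, rfl⟩ := (LinearPMap.mem_graph_iff L).mp hy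
  exact hf a b

/-- Every pair in the graph of `L` comes from the resolvent. -/
theorem resolvent_apply_of_mem_graph {L : H →ₗ.[ℂ] H} (hL : IsSelfAdjoint L) {x y : H}
    (h : (x, y) ∈ L.graph) : resolvent L (y + Complex.I • x) = x := by
  have h1 := resolvent_spec hL (y + Complex.I • x)
  set z := resolvent L (y + Complex.I • x)
  have h2 := L.graph.sub_mem h1 h
  obtain ⟨a, ha1, ha2⟩ := (LinearPMap.mem_graph_iff L).mp h2
  have h3 := norm_sq_of_selfAdjoint hL a
  simp only [Prod.mk_sub_mk] at ha1 ha2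
  rw [ha1, ha2] at h3
  have h4 : y + Complex.I • x - Complex.I • z - y + Complex.I • (z - x) = 0 := by
    rw [smul_sub]; abel
  rw [h4, norm_zero] at h3
  have h5 : ‖z - x‖ = 0 := by
    nlinarith [sq_nonneg ‖y + Complex.I • x - Complex.I • z - y‖, sq_nonneg ‖z - x‖]
  exact sub_eq_zero.mp (norm_eq_zero.mp h5)

theorem inner_resolvent_sub {L : H →ₗ.[ℂ] H} (hL : IsSelfAdjoint L) (f g : H) :
    inner ℂ f (resolvent L g) - inner ℂ (resolvent L f) g =
      -(2 * Complex.I) * inner ℂ (resolvent L f) (resolvent L g) := by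
  have h := inner_apply_of_mem_graph hL (resolvent_spec hL f) (resolvent_spec hL g)
  simp only [inner_sub_left, inner_sub_right, inner_smul_left, inner_smul_right,
    Complex.conj_I] at h
  linear_combination h

theorem resolvent_sub_star {L : H →ₗ.[ℂ] H} (hL : IsSelfAdjoint L) :
    resolvent L - star (resolvent L) =
      -(2 * Complex.I) • (star (resolvent L) * resolvent L) := by
  ext g
  refine ext_inner_left ℂ fun f => ?_
  have := inner_resolvent_sub hL f g
  simp only [sub_apply, smul_apply,
    mul_apply_eq_comp, ContinuousLinearMap.star_eq_adjoint, inner_sub_right,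
    inner_smul_right, ContinuousLinearMap.adjoint_inner_right]
  exact this

theorem isStarNormal_resolvent {L : H →ₗ.[ℂ] H} (hL : IsSelfAdjoint L) :
    IsStarNormal (resolvent L) := by
  set R := resolvent L with hR
  have h1 : R - star R = -(2 * Complex.I) • (star R * R) := resolvent_sub_star hL
  set V : H →L[ℂ] H := 1 - (2 * Complex.I) • R with hV
  have hVs : star V = 1 + (2 * Complex.I) • star R := by
    rw [hV, star_sub, star_one, star_smul]
    rw [show star (2 * Complex.I) = -(2 * Complex.I) by simp, neg_smul, sub_neg_eq_add]
  have hI : (2 * Complex.I) * (2 * Complex.I) = -4 := by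
    linear_combination 4 * Complex.I_mul_I
  have hVV : star V * V = 1 := by
    have : star V * V = 1 - (2 * Complex.I) • (R - star R)
        - ((2 * Complex.I) * (2 * Complex.I)) • (star R * R) := by
      rw [hVs, hV, mul_sub, add_mul, add_mul, smul_mul_smul_comm, smul_sub]
      simp only [one_mul, mul_one]
      abel
    rw [this, h1, smul_smul, mul_neg, hI]
    simp
  have hker : ∀ y, star V y = 0 → y = 0 := by
    intro y hy
    have h0 : ∀ x : L.domain, inner ℂ (-Complex.I • y) (x : H) = inner ℂ y (L x) := by
      intro x
      have h2 : inner ℂ (star V y) (L x + Complex.I • (x : H)) = 0 := by rw [hy, inner_zero_left]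
      rw [ContinuousLinearMap.star_eq_adjoint, ContinuousLinearMap.adjoint_inner_left] at h2
      have h3 : V (L x + Complex.I • (x : H)) = L x - Complex.I • (x : H) := by
        rw [hV, sub_apply, smul_apply,
          resolvent_apply_of_mem_graph hL (LinearPMap.mem_graph L x), mul_smul, two_smul]
        simp only [one_apply_eq_self]
        abel
      rw [h3, inner_sub_right, inner_smul_right] at h2
      rw [inner_smul_left, map_neg, Complex.conj_I]
      linear_combination -h2
    have hyd : y ∈ (LinearPMap.adjoint L).domain :=
      LinearPMap.mem_adjoint_domain_of_exists y ⟨_, h0⟩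
    have hap : LinearPMap.adjoint L ⟨y, hyd⟩ = -Complex.I • y :=
      LinearPMap.adjoint_apply_eq hL.dense_domain ⟨y, hyd⟩ h0
    have hg : (y, -Complex.I • y) ∈ L.graph := by
      have hg' : (y, -Complex.I • y) ∈ (LinearPMap.adjoint L).graph := by
        rw [LinearPMap.mem_graph_iff]
        exact ⟨⟨y, hyd⟩, rfl, hap⟩
      rwa [LinearPMap.isSelfAdjoint_def.mp hL] at hg'
    have := resolvent_apply_of_mem_graph hL hg
    rw [← this, neg_smul, neg_add_cancel, map_zero]
  have hVV' : V * star V = 1 := by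
    ext x
    have : star V ((V * star V) x - x) = 0 := by
      rw [map_sub, sub_eq_zero]
      have h5 : star V * (V * star V) = star V := by rw [← mul_assoc, hVV, one_mul]
      exact congrArg (fun T : H →L[ℂ] H => T x) h5
    simpa [sub_eq_zero] using hker _ this
  have h6 : V * star V = 1 - (2 * Complex.I) • (R - star R)
        - ((2 * Complex.I) * (2 * Complex.I)) • (R * star R) := by
    rw [hVs, hV, mul_add, sub_mul, sub_mul, smul_mul_smul_comm, smul_sub]
    simp only [one_mul, mul_one]
    abel
  rw [hVV', h1, smul_smul, mul_neg, hI] at h6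
  refine ⟨?_⟩
  have h7 : (4 : ℂ) • (R * star R) = (4 : ℂ) • (star R * R) := by
    have h8 : (4 : ℂ) • (R * star R) - (4 : ℂ) • (star R * R) = 0 := by
      calc _ = (1 - (- -4 : ℂ) • (star R * R) - (-4 : ℂ) • (R * star R)) - 1 := by
            simp only [neg_neg, neg_smul]; abel
        _ = 0 := by rw [← h6, sub_self]
    exact sub_eq_zero.mp h8
  exact (smul_right_injective _ (by norm_num : (4 : ℂ) ≠ 0) h7).symm

/-- The nonzero points of the spectrum of the resolvent are of the form `(x + i)⁻¹`, `x` real. -/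
theorem inv_eq_of_mem_spectrum {L : H →ₗ.[ℂ] H} (hL : IsSelfAdjoint L) {r : ℂ}
    (hr : r ∈ spectrum ℂ (resolvent L)) (h0 : r ≠ 0) :
    r⁻¹ = ((r⁻¹).re : ℂ) + Complex.I := by
  have := isStarNormal_resolvent hL
  set R := resolvent L
  have h1 : cfc (fun r : ℂ => r - star r - -(2 * Complex.I) * (star r * r)) R = 0 := by
    rw [cfc_sub _ _ R (by fun_prop) (by fun_prop), cfc_sub _ _ R (by fun_prop) (by fun_prop),
      cfc_const_mul _ _ R (by fun_prop), cfc_mul _ _ R (by fun_prop) (by fun_prop), cfc_star_id R,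
      cfc_id' ℂ R, resolvent_sub_star hL, sub_self]
  have h2 := norm_apply_le_norm_cfc (fun r : ℂ => r - star r - -(2 * Complex.I) * (star r * r)) R
    hr (by fun_prop) this
  rw [h1, norm_zero] at h2
  have h3 := norm_le_zero_iff.mp h2
  have hs : star r ≠ 0 := star_ne_zero.mpr h0
  have h4 : r⁻¹ - star r⁻¹ = 2 * Complex.I := by
    rw [star_inv₀]
    field_simp
    linear_combination -h3
  apply Complex.ext
  · simp
  · have := congrArg Complex.im h4
    simp at this ⊢
    rw [neg_div] at this ⊢
    linarith

/-! ### The bounded functional calculus -/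

/-- The points `x` of the spectrum of the self-adjoint operator `L`. -/
def realSpec (L : H →ₗ.[ℂ] H) : Set ℝ :=
  {x | ((x : ℂ) + Complex.I)⁻¹ ∈ spectrum ℂ (resolvent L)}

/-- The function on the spectrum of `(L + i)⁻¹` that corresponds to `φ`. -/
def lift (φ : ℝ → ℂ) (r : ℂ) : ℂ := if r = 0 then 0 else φ (r⁻¹).re

/-- `φ(L)` for `φ : ℝ → ℂ` continuous and vanishing at infinity on the spectrum of `L`. -/
def boundedCalc (L : H →ₗ.[ℂ] H) (φ : ℝ → ℂ) : H →L[ℂ] H := cfc (lift φ) (resolvent L)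

theorem compactCalc_eq (L : H →ₗ.[ℂ] H) (ψ : ℝ → ℝ) :
    compactCalc L ψ = boundedCalc L (fun x => (ψ x : ℂ)) := rfl

/-- `φ` is continuous on the spectrum of `L` and tends to zero at infinity there. -/
structure VanishesAtInfty (L : H →ₗ.[ℂ] H) (φ : ℝ → ℂ) : Prop where
  continuousOn : ContinuousOn φ (realSpec L)
  tendsto : Tendsto φ (cocompact ℝ ⊓ 𝓟 (realSpec L)) (𝓝 0)

theorem ofReal_add_I_ne_zero (x : ℝ) : (x : ℂ) + Complex.I ≠ 0 := by
  intro h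
  have := congrArg Complex.im h
  simp at this

theorem lift_inv (φ : ℝ → ℂ) (x : ℝ) : lift φ ((x : ℂ) + Complex.I)⁻¹ = φ x := by
  rw [lift, if_neg (inv_ne_zero (ofReal_add_I_ne_zero x)), inv_inv]
  simp

theorem re_inv_mem_realSpec {L : H →ₗ.[ℂ] H} (hL : IsSelfAdjoint L) {r : ℂ}
    (hr : r ∈ spectrum ℂ (resolvent L)) (h0 : r ≠ 0) : (r⁻¹).re ∈ realSpec L := by
  rw [realSpec, Set.mem_ofPred_eq, ← inv_eq_of_mem_spectrum hL hr h0, inv_inv]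
  exact hr

theorem VanishesAtInfty.continuousOn_lift {L : H →ₗ.[ℂ] H} (hL : IsSelfAdjoint L) {φ : ℝ → ℂ}
    (hφ : VanishesAtInfty L φ) : ContinuousOn (lift φ) (spectrum ℂ (resolvent L)) := by
  intro r hr
  by_cases h0 : r = 0
  · subst h0
    have hl0 : lift φ 0 = 0 := if_pos rfl
    rw [ContinuousWithinAt, hl0, Metric.tendsto_nhds]
    intro ε hε
    have h1 := Metric.tendsto_nhds.mp hφ.tendsto ε hε
    rw [eventually_inf_principal, (hasBasis_cocompact.eventually_iff)] at h1
    obtain ⟨K, hK, hK'⟩ := h1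
    obtain ⟨M, hM⟩ := hK.isBounded.exists_norm_le
    have h2 : ∀ᶠ r : ℂ in 𝓝 0, ‖r‖ * (|M| + 1 + 1) < 1 := by
      have : Tendsto (fun r : ℂ => ‖r‖ * (|M| + 1 + 1)) (𝓝 0) (𝓝 (‖(0 : ℂ)‖ * (|M| + 1 + 1))) :=
        (continuous_norm.mul continuous_const).tendsto 0
      rw [norm_zero, zero_mul] at this
      exact this.eventually_lt_const one_pos
    filter_upwards [self_mem_nhdsWithin, nhdsWithin_le_nhds h2] with r hr hr2
    by_cases h0 : r = 0
    · rw [h0, hl0, dist_self]; exact hε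
    · rw [lift, if_neg h0]
      refine hK' ?_ (re_inv_mem_realSpec hL hr h0)
      intro hmem
      have h3 := hM _ hmem
      have h4 : ‖r⁻¹‖ ≤ |M| + 1 := by
        rw [inv_eq_of_mem_spectrum hL hr h0]
        refine (norm_add_le _ _).trans ?_
        rw [Complex.norm_real, Complex.norm_I]
        linarith [le_abs_self M]
      have h5 : 1 ≤ ‖r‖ * (|M| + 1) := by
        calc (1 : ℝ) = ‖r‖ * ‖r⁻¹‖ := by rw [← norm_mul, mul_inv_cancel₀ h0, norm_one]
          _ ≤ _ := by gcongr
      nlinarith [norm_nonneg r]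
  · have h1 : ContinuousWithinAt (fun r : ℂ => φ (r⁻¹).re)
        (spectrum ℂ (resolvent L) ∩ {0}ᶜ) r := by
      refine ContinuousWithinAt.comp (t := realSpec L) (f := fun r : ℂ => (r⁻¹).re)
        (hφ.continuousOn _ (re_inv_mem_realSpec hL hr h0)) ?_ ?_
      · exact (Complex.continuous_re.continuousAt.comp
          (continuousAt_inv₀ h0)).continuousWithinAt
      · exact fun s hs => re_inv_mem_realSpec hL hs.1 hs.2
    have h2 : ContinuousWithinAt (fun r : ℂ => φ (r⁻¹).re) (spectrum ℂ (resolvent L)) r :=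
      (continuousWithinAt_inter (isOpen_compl_singleton.mem_nhds h0)).mp h1
    refine h2.congr_of_eventuallyEq ?_ (if_neg h0)
    filter_upwards [nhdsWithin_le_nhds (isOpen_compl_singleton.mem_nhds h0)] with s hs
    exact if_neg hs

theorem VanishesAtInfty.exists_bound {L : H →ₗ.[ℂ] H} (hL : IsSelfAdjoint L) {φ : ℝ → ℂ}
    (hφ : VanishesAtInfty L φ) : ∃ B, ∀ x ∈ realSpec L, ‖φ x‖ ≤ B := by
  obtain ⟨B, hB⟩ := (spectrum.isCompact (𝕜 := ℂ) (resolvent L)).exists_bound_of_continuousOn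
    (hφ.continuousOn_lift hL)
  refine ⟨B, fun x hx => ?_⟩
  have := hB _ hx
  rwa [lift_inv] at this

theorem VanishesAtInfty.add {L : H →ₗ.[ℂ] H} {φ ψ : ℝ → ℂ}
    (hφ : VanishesAtInfty L φ) (hψ : VanishesAtInfty L ψ) :
    VanishesAtInfty L (fun x => φ x + ψ x) :=
  ⟨hφ.1.add hψ.1, by simpa using hφ.2.add hψ.2⟩

theorem VanishesAtInfty.sub {L : H →ₗ.[ℂ] H} {φ ψ : ℝ → ℂ}
    (hφ : VanishesAtInfty L φ) (hψ : VanishesAtInfty L ψ) :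
    VanishesAtInfty L (fun x => φ x - ψ x) :=
  ⟨hφ.1.sub hψ.1, by simpa using hφ.2.sub hψ.2⟩

theorem VanishesAtInfty.bdd_mul {L : H →ₗ.[ℂ] H} {φ ψ : ℝ → ℂ} {B : ℝ}
    (hφ : ContinuousOn φ (realSpec L)) (hB : ∀ x ∈ realSpec L, ‖φ x‖ ≤ B)
    (hψ : VanishesAtInfty L ψ) : VanishesAtInfty L (fun x => φ x * ψ x) := by
  refine ⟨hφ.mul hψ.1, ?_⟩
  have h := hψ.2.norm.const_mul B
  rw [norm_zero, mul_zero] at h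
  refine squeeze_zero_norm' (eventually_inf_principal.mpr (Eventually.of_forall fun x hx => ?_)) h
  rw [norm_mul]
  exact mul_le_mul_of_nonneg_right (hB x hx) (norm_nonneg _)

theorem VanishesAtInfty.mul {L : H →ₗ.[ℂ] H} (hL : IsSelfAdjoint L) {φ ψ : ℝ → ℂ}
    (hφ : VanishesAtInfty L φ) (hψ : VanishesAtInfty L ψ) :
    VanishesAtInfty L (fun x => φ x * ψ x) :=
  let ⟨_, hB⟩ := hφ.exists_bound hL
  .bdd_mul hφ.1 hB hψ

theorem VanishesAtInfty.congr {L : H →ₗ.[ℂ] H} {φ ψ : ℝ → ℂ}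
    (hφ : VanishesAtInfty L φ) (h : Set.EqOn ψ φ (realSpec L)) : VanishesAtInfty L ψ := by
  refine ⟨hφ.1.congr h, hφ.2.congr' ?_⟩
  exact eventually_inf_principal.mpr (Eventually.of_forall fun x hx => (h hx).symm)

theorem vanishesAtInfty_of_compact {L : H →ₗ.[ℂ] H} {φ : ℝ → ℂ} (hc : ContinuousOn φ (realSpec L))
    (h : ∃ M, ∀ x, M < |x| → φ x = 0) : VanishesAtInfty L φ := by
  refine ⟨hc, tendsto_const_nhds.congr' (Eventually.filter_mono inf_le_left ?_)⟩
  obtain ⟨M, hM⟩ := h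
  rw [hasBasis_cocompact.eventually_iff]
  refine ⟨Metric.closedBall 0 M, isCompact_closedBall _ _, fun x hx => (hM x ?_).symm⟩
  simpa using hx

theorem vanishesAtInfty_inv (L : H →ₗ.[ℂ] H) :
    VanishesAtInfty L (fun x => ((x : ℂ) + Complex.I)⁻¹) := by
  refine ⟨Continuous.continuousOn ?_, Tendsto.mono_left ?_ inf_le_left⟩
  · exact Continuous.inv₀ (by fun_prop) ofReal_add_I_ne_zero
  · refine tendsto_inv₀_cobounded.comp ?_
    rw [← tendsto_norm_atTop_iff_cobounded]
    refine tendsto_atTop_mono (fun x => ?_) (tendsto_norm_cocompact_atTop (E := ℝ))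
    simpa using Complex.abs_re_le_norm ((x : ℂ) + Complex.I)

theorem boundedCalc_congr {L : H →ₗ.[ℂ] H} (hL : IsSelfAdjoint L) {φ ψ : ℝ → ℂ}
    (h : Set.EqOn φ ψ (realSpec L)) : boundedCalc L φ = boundedCalc L ψ := by
  refine cfc_congr fun r hr => ?_
  by_cases h0 : r = 0
  · simp [lift, h0]
  · rw [lift, lift, if_neg h0, if_neg h0]
    exact h (re_inv_mem_realSpec hL hr h0)

theorem boundedCalc_mul {L : H →ₗ.[ℂ] H} (hL : IsSelfAdjoint L) {φ ψ : ℝ → ℂ}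
    (hφ : VanishesAtInfty L φ) (hψ : VanishesAtInfty L ψ) :
    boundedCalc L (fun x => φ x * ψ x) = boundedCalc L φ * boundedCalc L ψ := by
  rw [boundedCalc, boundedCalc, boundedCalc,
    ← cfc_mul _ _ _ (hφ.continuousOn_lift hL) (hψ.continuousOn_lift hL)]
  congr 1
  funext r
  by_cases h0 : r = 0 <;> simp [lift, h0]

theorem boundedCalc_add {L : H →ₗ.[ℂ] H} (hL : IsSelfAdjoint L) {φ ψ : ℝ → ℂ}
    (hφ : VanishesAtInfty L φ) (hψ : VanishesAtInfty L ψ) :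
    boundedCalc L (fun x => φ x + ψ x) = boundedCalc L φ + boundedCalc L ψ := by
  rw [boundedCalc, boundedCalc, boundedCalc,
    ← cfc_add _ _ _ (hφ.continuousOn_lift hL) (hψ.continuousOn_lift hL)]
  congr 1
  funext r
  by_cases h0 : r = 0 <;> simp [lift, h0]

theorem boundedCalc_sub {L : H →ₗ.[ℂ] H} (hL : IsSelfAdjoint L) {φ ψ : ℝ → ℂ}
    (hφ : VanishesAtInfty L φ) (hψ : VanishesAtInfty L ψ) :
    boundedCalc L (fun x => φ x - ψ x) = boundedCalc L φ - boundedCalc L ψ := by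
  rw [boundedCalc, boundedCalc, boundedCalc,
    ← cfc_sub _ _ _ (hφ.continuousOn_lift hL) (hψ.continuousOn_lift hL)]
  congr 1
  funext r
  by_cases h0 : r = 0 <;> simp [lift, h0]

theorem boundedCalc_const_mul {L : H →ₗ.[ℂ] H} (hL : IsSelfAdjoint L) {φ : ℝ → ℂ} (c : ℂ)
    (hφ : VanishesAtInfty L φ) :
    boundedCalc L (fun x => c * φ x) = c • boundedCalc L φ := by
  rw [boundedCalc, boundedCalc, ← cfc_const_mul _ _ _ (hφ.continuousOn_lift hL)]
  congr 1
  funext r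
  by_cases h0 : r = 0 <;> simp [lift, h0]

theorem boundedCalc_zero (L : H →ₗ.[ℂ] H) : boundedCalc L (fun _ => 0) = 0 := by
  have : lift (fun _ => 0) = 0 := by
    funext r
    simp [lift]
  rw [boundedCalc, this, cfc_zero]

theorem VanishesAtInfty.sum {L : H →ₗ.[ℂ] H} {ι : Type*} (s : Finset ι)
    {φ : ι → ℝ → ℂ} (hφ : ∀ i ∈ s, VanishesAtInfty L (φ i)) :
    VanishesAtInfty L (fun x => ∑ i ∈ s, φ i x) :=
  ⟨continuousOn_finsetSum _ fun i hi => (hφ i hi).1, by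
    simpa using tendsto_finsetSum s fun i hi => (hφ i hi).2⟩

theorem boundedCalc_sum {L : H →ₗ.[ℂ] H} (hL : IsSelfAdjoint L) {ι : Type*} (s : Finset ι)
    {φ : ι → ℝ → ℂ} (hφ : ∀ i ∈ s, VanishesAtInfty L (φ i)) :
    boundedCalc L (fun x => ∑ i ∈ s, φ i x) = ∑ i ∈ s, boundedCalc L (φ i) := by
  classical
  induction s using Finset.induction_on with
  | empty => simpa using boundedCalc_zero L
  | insert a s ha ih =>
    simp only [Finset.sum_insert ha]
    rw [boundedCalc_add hL (hφ a (Finset.mem_insert_self a s)) (.sum s fun i hi =>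
      hφ i (Finset.mem_insert_of_mem hi)), ih fun i hi => hφ i (Finset.mem_insert_of_mem hi)]

theorem star_boundedCalc (L : H →ₗ.[ℂ] H) (φ : ℝ → ℂ) :
    star (boundedCalc L φ) = boundedCalc L (fun x => conj (φ x)) := by
  rw [boundedCalc, boundedCalc, ← cfc_star]
  congr 1
  funext r
  by_cases h0 : r = 0 <;> simp [lift, h0]

theorem inner_boundedCalc_ofReal (L : H →ₗ.[ℂ] H) (φ : ℝ → ℝ) (f g : H) :
    inner ℂ (boundedCalc L (fun x => (φ x : ℂ)) f) g =
      inner ℂ f (boundedCalc L (fun x => (φ x : ℂ)) g) := by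
  have h := star_boundedCalc L (fun x => (φ x : ℂ))
  simp only [Complex.conj_ofReal] at h
  rw [← ContinuousLinearMap.adjoint_inner_right, ← ContinuousLinearMap.star_eq_adjoint, h]

theorem norm_boundedCalc_le {L : H →ₗ.[ℂ] H} (hL : IsSelfAdjoint L) {φ : ℝ → ℂ} {c : ℝ}
    (hc : 0 ≤ c) (h : ∀ x ∈ realSpec L, ‖φ x‖ ≤ c) : ‖boundedCalc L φ‖ ≤ c := by
  refine norm_cfc_le hc fun r hr => ?_
  by_cases h0 : r = 0
  · simpa [lift, h0] using hc
  · rw [lift, if_neg h0]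
    exact h _ (re_inv_mem_realSpec hL hr h0)

theorem norm_boundedCalc_apply_le {L : H →ₗ.[ℂ] H} (hL : IsSelfAdjoint L) {φ : ℝ → ℂ} {c : ℝ}
    (hc : 0 ≤ c) (h : ∀ x ∈ realSpec L, ‖φ x‖ ≤ c) (f : H) :
    ‖boundedCalc L φ f‖ ≤ c * ‖f‖ :=
  (ContinuousLinearMap.le_opNorm _ _).trans
    (mul_le_mul_of_nonneg_right (norm_boundedCalc_le hL hc h) (norm_nonneg f))

theorem norm_le_norm_boundedCalc {L : H →ₗ.[ℂ] H} (hL : IsSelfAdjoint L) {φ : ℝ → ℂ}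
    (hφ : VanishesAtInfty L φ) {x : ℝ} (hx : x ∈ realSpec L) : ‖φ x‖ ≤ ‖boundedCalc L φ‖ := by
  have := norm_apply_le_norm_cfc (lift φ) (resolvent L) hx (hφ.continuousOn_lift hL)
    (isStarNormal_resolvent hL)
  rwa [lift_inv] at this

theorem boundedCalc_inv {L : H →ₗ.[ℂ] H} (hL : IsSelfAdjoint L) :
    boundedCalc L (fun x => ((x : ℂ) + Complex.I)⁻¹) = resolvent L := by
  have := isStarNormal_resolvent hL
  rw [boundedCalc]
  conv_rhs => rw [← cfc_id ℂ (resolvent L)]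
  refine cfc_congr fun r hr => ?_
  by_cases h0 : r = 0
  · simp [lift, h0]
  · rw [lift, if_neg h0, ← inv_eq_of_mem_spectrum hL hr h0, inv_inv, id]

theorem boundedCalc_mem_graph {L : H →ₗ.[ℂ] H} (hL : IsSelfAdjoint L) {φ : ℝ → ℂ}
    (hφ : VanishesAtInfty L φ) (hφ' : VanishesAtInfty L (fun x => (x : ℂ) * φ x)) (f : H) :
    (boundedCalc L φ f, boundedCalc L (fun x => (x : ℂ) * φ x) f) ∈ L.graph := by
  have hI : VanishesAtInfty L (fun x => Complex.I * φ x) :=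
    .bdd_mul (B := 1) continuousOn_const (fun _ _ => by simp) hφ
  set y := boundedCalc L (fun x => (x : ℂ) * φ x) f + Complex.I • boundedCalc L φ f with hy
  have h1 : resolvent L y = boundedCalc L φ f := by
    have h2 : resolvent L * boundedCalc L (fun x => (x : ℂ) * φ x + Complex.I * φ x)
        = boundedCalc L φ := by
      rw [← boundedCalc_inv hL, ← boundedCalc_mul hL (vanishesAtInfty_inv L) (hφ'.add hI)]
      congr 1
      funext x
      rw [← add_mul, inv_mul_cancel_left₀ (ofReal_add_I_ne_zero x)]
    rw [boundedCalc_add hL hφ' hI, boundedCalc_const_mul hL _ hφ] at h2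
    exact congrArg (fun T : H →L[ℂ] H => T f) h2
  have h3 := resolvent_spec hL y
  rw [h1] at h3
  convert h3 using 2
  rw [hy, add_sub_cancel_right]

/-! ### Convergence -/

theorem tendsto_boundedCalc {L : H →ₗ.[ℂ] H} (hL : IsSelfAdjoint L) {φ : ℕ → ℝ → ℂ}
    {ψ : ℝ → ℂ} (hφ : ∀ n, VanishesAtInfty L (φ n)) (hψ : VanishesAtInfty L ψ)
    (h : TendstoUniformlyOn φ ψ atTop (realSpec L)) :
    Tendsto (fun n => boundedCalc L (φ n)) atTop (𝓝 (boundedCalc L ψ)) := by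
  rw [Metric.tendsto_nhds]
  intro ε hε
  filter_upwards [Metric.tendstoUniformlyOn_iff.mp h (ε / 2) (half_pos hε)] with n hn
  rw [dist_eq_norm, ← boundedCalc_sub hL (hφ n) hψ]
  refine (norm_boundedCalc_le hL (half_pos hε).le fun x hx => ?_).trans_lt (half_lt_self hε)
  rw [← dist_eq_norm, dist_comm]
  exact (hn x hx).le

theorem cutoff_nonneg (n : ℕ) (x : ℝ) : 0 ≤ cutoff n x := le_max_left _ _

theorem cutoff_le_one (n : ℕ) (x : ℝ) : cutoff n x ≤ 1 :=
  max_le zero_le_one (by have : 0 ≤ |x| / (n + 1) := by positivity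
                         linarith)

theorem continuous_cutoff (n : ℕ) : Continuous (cutoff n) := by
  unfold cutoff
  fun_prop

theorem one_sub_cutoff_le (n : ℕ) (x : ℝ) : 1 - cutoff n x ≤ |x| / (n + 1) := by
  have := le_max_right 0 (1 - |x| / (n + 1))
  unfold cutoff
  linarith

theorem cutoff_eq_zero {n : ℕ} {x : ℝ} (h : (n : ℝ) + 1 < |x|) : cutoff n x = 0 := by
  refine max_eq_left ?_
  have : 1 ≤ |x| / (n + 1) := by
    rw [one_le_div (by positivity)]
    exact h.le
  linarith

theorem vanishesAtInfty_mul_cutoff {L : H →ₗ.[ℂ] H} {φ : ℝ → ℂ}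
    (hφ : ContinuousOn φ (realSpec L)) (n : ℕ) :
    VanishesAtInfty L (fun x => φ x * cutoff n x) := by
  refine vanishesAtInfty_of_compact (hφ.mul ?_) ⟨n + 1, fun x hx => ?_⟩
  · exact (Complex.continuous_ofReal.comp (continuous_cutoff n)).continuousOn
  · rw [cutoff_eq_zero hx, Complex.ofReal_zero, mul_zero]

theorem tendstoUniformlyOn_mul_cutoff {L : H →ₗ.[ℂ] H} (hL : IsSelfAdjoint L) {φ : ℝ → ℂ}
    (hφ : VanishesAtInfty L φ) :
    TendstoUniformlyOn (fun n x => φ x * cutoff n x) φ atTop (realSpec L) := by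
  rw [Metric.tendstoUniformlyOn_iff]
  intro ε hε
  obtain ⟨B, hB⟩ := hφ.exists_bound hL
  have h1 := Metric.tendsto_nhds.mp hφ.tendsto ε hε
  rw [eventually_inf_principal, hasBasis_cocompact.eventually_iff] at h1
  obtain ⟨K, hK, hK'⟩ := h1
  obtain ⟨M, hM⟩ := hK.isBounded.exists_norm_le
  have h2 : Tendsto (fun n : ℕ => |B| * (|M| / ((n : ℝ) + 1))) atTop (𝓝 (|B| * 0)) :=
    (tendsto_const_nhds.div_atTop
      (tendsto_atTop_add_const_right _ _ tendsto_natCast_atTop_atTop)).const_mul _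
  rw [mul_zero] at h2
  filter_upwards [h2.eventually_lt_const hε] with n hn x hx
  have h3 : dist (φ x) (φ x * cutoff n x) = ‖φ x‖ * (1 - cutoff n x) := by
    rw [dist_eq_norm, ← mul_one_sub, norm_mul, ← Complex.ofReal_one, ← Complex.ofReal_sub,
      Complex.norm_real, Real.norm_of_nonneg (sub_nonneg.mpr (cutoff_le_one n x))]
  rw [h3]
  by_cases hxK : x ∈ K
  · refine lt_of_le_of_lt ?_ hn
    refine mul_le_mul ((hB x hx).trans (le_abs_self B)) ((one_sub_cutoff_le n x).trans ?_)
      (by linarith [cutoff_le_one n x]) (abs_nonneg B)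
    exact div_le_div_of_nonneg_right ((hM x hxK).trans (le_abs_self M)) (by positivity)
  · have h4 := hK' hxK hx
    rw [dist_zero_right] at h4
    refine lt_of_le_of_lt ?_ h4
    exact mul_le_of_le_one_right (norm_nonneg _) (by linarith [cutoff_nonneg n x])

theorem tendsto_boundedCalc_mul_cutoff {L : H →ₗ.[ℂ] H} (hL : IsSelfAdjoint L) {φ : ℝ → ℂ}
    (hφ : VanishesAtInfty L φ) :
    Tendsto (fun n => boundedCalc L (fun x => φ x * cutoff n x)) atTop (𝓝 (boundedCalc L φ)) :=
  tendsto_boundedCalc hL (fun n => vanishesAtInfty_mul_cutoff hφ.1 n) hφ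
    (tendstoUniformlyOn_mul_cutoff hL hφ)

theorem tendsto_apply {T : ℕ → H →L[ℂ] H} {T₀ : H →L[ℂ] H} (h : Tendsto T atTop (𝓝 T₀)) (f : H) :
    Tendsto (fun n => T n f) atTop (𝓝 (T₀ f)) :=
  ((ContinuousLinearMap.apply ℂ H f).continuous.tendsto T₀).comp h

theorem denseRange_resolvent {L : H →ₗ.[ℂ] H} (hL : IsSelfAdjoint L) :
    DenseRange (resolvent L) := by
  refine hL.dense_domain.mono fun x hx => ?_
  exact ⟨_, resolvent_apply_of_mem_graph hL (LinearPMap.mem_graph L ⟨x, hx⟩)⟩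

/-- Strong convergence to the identity. -/
theorem tendsto_boundedCalc_apply_self {L : H →ₗ.[ℂ] H} (hL : IsSelfAdjoint L) {φ : ℕ → ℝ → ℂ}
    (hφ : ∀ n, VanishesAtInfty L (φ n)) (hb : ∀ n, ∀ x ∈ realSpec L, ‖φ n x‖ ≤ 1)
    (h : TendstoUniformlyOn (fun n x => φ n x * ((x : ℂ) + Complex.I)⁻¹)
      (fun x => ((x : ℂ) + Complex.I)⁻¹) atTop (realSpec L)) (f : H) :
    Tendsto (fun n => boundedCalc L (φ n) f) atTop (𝓝 f) := by
  rw [Metric.tendsto_nhds]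
  intro ε hε
  obtain ⟨g, hg⟩ := (denseRange_resolvent hL).exists_dist_lt f (by positivity : 0 < ε / 3)
  have h1 := tendsto_boundedCalc hL (fun n => (hφ n).mul hL (vanishesAtInfty_inv L))
    (vanishesAtInfty_inv L) h
  simp only [boundedCalc_mul hL (hφ _) (vanishesAtInfty_inv L), boundedCalc_inv hL] at h1
  filter_upwards [Metric.tendsto_nhds.mp (tendsto_apply h1 g) (ε / 3) (by positivity)] with n hn
  have h2 : dist (boundedCalc L (φ n) f) (boundedCalc L (φ n) (resolvent L g)) < ε / 3 := by
    rw [dist_eq_norm, ← map_sub]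
    refine lt_of_le_of_lt (norm_boundedCalc_apply_le hL zero_le_one (hb n) _) ?_
    rwa [one_mul, ← dist_eq_norm]
  have h3 := dist_triangle4 (boundedCalc L (φ n) f) (boundedCalc L (φ n) (resolvent L g))
    (resolvent L g) f
  rw [dist_comm] at hg
  rw [mul_apply_eq_comp] at hn
  linarith

theorem norm_cutoff_le_one (n : ℕ) (x : ℝ) : ‖(cutoff n x : ℂ)‖ ≤ 1 := by
  rw [Complex.norm_real, Real.norm_of_nonneg (cutoff_nonneg n x)]
  exact cutoff_le_one n x

theorem vanishesAtInfty_cutoff (L : H →ₗ.[ℂ] H) (n : ℕ) :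
    VanishesAtInfty L (fun x => (cutoff n x : ℂ)) := by
  simpa using vanishesAtInfty_mul_cutoff (L := L) (φ := fun _ => 1) continuousOn_const n

theorem tendsto_boundedCalc_cutoff {L : H →ₗ.[ℂ] H} (hL : IsSelfAdjoint L) (f : H) :
    Tendsto (fun n => boundedCalc L (fun x => (cutoff n x : ℂ)) f) atTop (𝓝 f) := by
  refine tendsto_boundedCalc_apply_self hL (fun n => vanishesAtInfty_cutoff L n)
    (fun n x _ => norm_cutoff_le_one n x) ?_ f
  simpa only [mul_comm] using tendstoUniformlyOn_mul_cutoff hL (vanishesAtInfty_inv L)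

/-! ### The functional calculus with domain -/

theorem mem_graph_funCalc {L : H →ₗ.[ℂ] H} {φ : ℝ → ℝ} {f g : H} :
    (f, g) ∈ (funCalc L φ).graph ↔
      Tendsto (fun n => boundedCalc L (fun x => (φ x : ℂ) * cutoff n x) f) atTop (𝓝 g) := by
  rw [mem_graph_funCalc_iff]
  simp only [compactCalc_eq, Complex.ofReal_mul]

theorem eq_of_mem_graph_funCalc {L : H →ₗ.[ℂ] H} (hL : IsSelfAdjoint L) {φ : ℝ → ℝ}
    (hφ : VanishesAtInfty L (fun x => (φ x : ℂ))) {f g : H} (h : (f, g) ∈ (funCalc L φ).graph) :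
    g = boundedCalc L (fun x => (φ x : ℂ)) f :=
  tendsto_nhds_unique (mem_graph_funCalc.mp h)
    (tendsto_apply (tendsto_boundedCalc_mul_cutoff hL hφ) f)

/-- `ψ(L) φ(L) u = (ψ φ)(L) u`. -/
theorem boundedCalc_apply_of_mem_graph {L : H →ₗ.[ℂ] H} (hL : IsSelfAdjoint L) {φ : ℝ → ℝ}
    (hφ : ContinuousOn φ (realSpec L)) {u h : H} (hu : (u, h) ∈ (funCalc L φ).graph) {ψ : ℝ → ℂ}
    (hψ : VanishesAtInfty L ψ) (hψφ : VanishesAtInfty L (fun x => ψ x * φ x)) :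
    boundedCalc L ψ h = boundedCalc L (fun x => ψ x * φ x) u := by
  have h1 := ((boundedCalc L ψ).continuous.tendsto h).comp (mem_graph_funCalc.mp hu)
  refine tendsto_nhds_unique h1 ?_
  have h2 := tendsto_apply (tendsto_boundedCalc_mul_cutoff hL hψφ) u
  refine h2.congr fun n => ?_
  have h3 : ContinuousOn (fun x => (φ x : ℂ)) (realSpec L) :=
    Complex.continuous_ofReal.comp_continuousOn hφ
  simp only [mul_assoc, boundedCalc_mul hL hψ (vanishesAtInfty_mul_cutoff h3 n)]
  rfl

end OpCalc

namespace OpCalc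

variable {H : Type*} [NormedAddCommGroup H] [InnerProductSpace ℂ H] [CompleteSpace H]

/-! ### Lower bounds of the spectrum -/

theorem vanishesAtInfty_of_tendsto_atTop_complex {L : H →ₗ.[ℂ] H} {m : ℝ}
    (hm : ∀ x ∈ realSpec L, m ≤ x) {φ : ℝ → ℂ} (hc : ContinuousOn φ (realSpec L))
    (h : Tendsto φ atTop (𝓝 0)) : VanishesAtInfty L φ := by
  refine ⟨hc, h.mono_left ?_⟩
  rw [cocompact_eq_atBot_atTop, inf_sup_right]
  refine sup_le ?_ inf_le_left
  have : atBot ⊓ 𝓟 (realSpec L) = ⊥ := by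
    rw [← disjoint_iff, disjoint_principal_right]
    filter_upwards [eventually_lt_atBot m] with x hx hxS
    exact absurd (hm x hxS) (not_le.mpr hx)
  rw [this]
  exact bot_le

theorem vanishesAtInfty_of_tendsto_atTop {L : H →ₗ.[ℂ] H} {m : ℝ} (hm : ∀ x ∈ realSpec L, m ≤ x)
    {φ : ℝ → ℝ} (hc : ContinuousOn φ (realSpec L)) (h : Tendsto φ atTop (𝓝 0)) :
    VanishesAtInfty L (fun x => (φ x : ℂ)) := by
  refine vanishesAtInfty_of_tendsto_atTop_complex hm
    (Complex.continuous_ofReal.comp_continuousOn hc) ?_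
  have h2 := (Complex.continuous_ofReal.tendsto 0).comp h
  rwa [Complex.ofReal_zero] at h2

theorem tendsto_exp_neg_mul_atTop {t : ℝ} (ht : 0 < t) :
    Tendsto (fun x => Real.exp (-t * x)) atTop (𝓝 0) :=
  Real.tendsto_exp_atBot.comp (tendsto_id.const_mul_atTop_of_neg (neg_neg_of_pos ht))

theorem vanishesAtInfty_exp {L : H →ₗ.[ℂ] H} {m : ℝ} (hm : ∀ x ∈ realSpec L, m ≤ x)
    {t : ℝ} (ht : 0 < t) : VanishesAtInfty L (fun x => (Real.exp (-t * x) : ℂ)) :=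
  vanishesAtInfty_of_tendsto_atTop hm (by fun_prop) (tendsto_exp_neg_mul_atTop ht)

theorem cutoff_pos {n : ℕ} {x : ℝ} (h : |x| ≤ n) : 0 < cutoff n x := by
  refine lt_max_of_lt_right ?_
  rw [sub_pos, div_lt_one (by positivity)]
  linarith

theorem neg_le_of_mem_realSpec {L : H →ₗ.[ℂ] H} (hL : IsSelfAdjoint L) {C ω : ℝ} (hC : 0 < C)
    (h : ∀ t : ℝ, 0 < t → ∀ f : H, ∃ g : H, (f, g) ∈ (expNeg L t).graph ∧
      ‖g‖ ≤ C * Real.exp (ω * t) * ‖f‖) : ∀ x ∈ realSpec L, -ω ≤ x := by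
  intro x hx
  by_contra hlt
  rw [not_le] at hlt
  obtain ⟨n, hn⟩ := exists_nat_ge |x|
  have hp := cutoff_pos hn
  have key : ∀ t : ℝ, 0 < t → cutoff n x * Real.exp (-t * x) ≤ C * Real.exp (ω * t) := by
    intro t ht
    have hc : ContinuousOn (fun x => Real.exp (-t * x)) (realSpec L) := by fun_prop
    have h1 : VanishesAtInfty L (fun x => (cutoff n x : ℂ) * (Real.exp (-t * x) : ℂ)) := by
      refine (vanishesAtInfty_mul_cutoff (Complex.continuous_ofReal.comp_continuousOn hc) n).congr
        fun x _ => mul_comm _ _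
    have h2 := norm_le_norm_boundedCalc hL h1 hx
    rw [← Complex.ofReal_mul, Complex.norm_real,
      Real.norm_of_nonneg (mul_nonneg hp.le (Real.exp_pos _).le)] at h2
    refine h2.trans (ContinuousLinearMap.opNorm_le_bound _ (by positivity) fun f => ?_)
    obtain ⟨g, hg, hgn⟩ := h t ht f
    rw [← boundedCalc_apply_of_mem_graph hL hc hg (vanishesAtInfty_cutoff L n) h1]
    refine (norm_boundedCalc_apply_le hL zero_le_one (fun x _ => norm_cutoff_le_one n x) g).trans ?_
    rwa [one_mul]
  set p := cutoff n x
  have hy : 0 < -(x + ω) := by linarith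
  have h3 := key (C / (p * -(x + ω))) (by positivity)
  set t := C / (p * -(x + ω)) with ht
  have h4 : p * Real.exp (t * -(x + ω)) ≤ C := by
    have h5 : Real.exp (-t * x) = Real.exp (t * -(x + ω)) * Real.exp (ω * t) := by
      rw [← Real.exp_add]; ring_nf
    rw [h5, ← mul_assoc] at h3
    exact le_of_mul_le_mul_right h3 (Real.exp_pos _)
  have h6 : p * (t * -(x + ω)) = C := by
    rw [mul_left_comm, ht, div_mul_cancel₀ _ (mul_pos hp hy).ne']
  have h7 := Real.add_one_le_exp (t * -(x + ω))
  nlinarith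

theorem nonneg_of_mem_realSpec {L : H →ₗ.[ℂ] H} (hL : IsSelfAdjoint L)
    (h : ∀ f : L.domain, 0 ≤ (inner ℂ (L f) (f : H)).re) : ∀ x ∈ realSpec L, 0 ≤ x := by
  intro x hx
  by_contra hlt
  rw [not_le] at hlt
  obtain ⟨n, hn⟩ := exists_nat_ge |x|
  have hp := cutoff_pos hn
  set ψ : ℝ → ℝ := fun x => Real.sqrt (max 0 (-x)) * cutoff n x with hψd
  set θ : ℝ → ℝ := fun x => max 0 (-x) * cutoff n x with hθd
  have hψ : VanishesAtInfty L (fun x => (ψ x : ℂ)) := by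
    simp only [hψd, Complex.ofReal_mul]
    exact vanishesAtInfty_mul_cutoff (Continuous.continuousOn (by fun_prop)) n
  have hθ : VanishesAtInfty L (fun x => (θ x : ℂ)) := by
    simp only [hθd, Complex.ofReal_mul]
    exact vanishesAtInfty_mul_cutoff (Continuous.continuousOn (by fun_prop)) n
  have hxψ : VanishesAtInfty L (fun x => (x : ℂ) * (ψ x : ℂ)) := by
    simp only [hψd, Complex.ofReal_mul, ← mul_assoc]
    exact vanishesAtInfty_mul_cutoff (Continuous.continuousOn (by fun_prop)) n
  have hid : ∀ x, (ψ x : ℂ) * ((x : ℂ) * (ψ x : ℂ)) = (-1) * ((θ x : ℂ) * (θ x : ℂ)) := by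
    intro x
    rw [← Complex.ofReal_mul, ← Complex.ofReal_mul, ← Complex.ofReal_mul]
    have : ψ x * (x * ψ x) = -1 * (θ x * θ x) := by
      have h1 := Real.mul_self_sqrt (le_max_left 0 (-x))
      rcases le_total 0 x with h0 | h0
      · simp [hψd, hθd, max_eq_left (neg_nonpos.mpr h0)]
      · rw [max_eq_right (neg_nonneg.mpr h0)] at h1
        simp only [hψd, hθd, max_eq_right (neg_nonneg.mpr h0)]
        linear_combination x * cutoff n x ^ 2 * h1
    rw [this]
    push_cast
    ring
  have h0 : boundedCalc L (fun x => (θ x : ℂ)) = 0 := by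
    ext f
    have h1 := boundedCalc_mem_graph hL hψ hxψ f
    obtain ⟨a, ha1, ha2⟩ := (LinearPMap.mem_graph_iff L).mp h1
    have h2 := h a
    simp only at ha1 ha2
    rw [ha1, ha2, ← inner_boundedCalc_ofReal, ← mul_apply_eq_comp, ← boundedCalc_mul hL hψ hxψ] at h2
    simp only [hid] at h2
    rw [boundedCalc_const_mul hL _ (hθ.mul hL hθ), boundedCalc_mul hL hθ hθ, neg_one_smul,
      neg_apply, mul_apply_eq_comp, inner_neg_left, inner_boundedCalc_ofReal,
      inner_self_eq_norm_sq_to_K] at h2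
    norm_cast at h2
    change 0 ≤ -‖boundedCalc L (fun x => (θ x : ℂ)) f‖ ^ 2 at h2
    have h3 : ‖boundedCalc L (fun x => (θ x : ℂ)) f‖ = 0 := by
      nlinarith [norm_nonneg (boundedCalc L (fun x => (θ x : ℂ)) f)]
    simpa using h3
  have h1 := norm_le_norm_boundedCalc hL hθ hx
  rw [h0, norm_zero, norm_le_zero_iff, Complex.ofReal_eq_zero] at h1
  have : 0 < θ x := mul_pos (lt_max_of_lt_right (by linarith)) hp
  exact this.ne' h1

end OpCalc

namespace SobolevOp

open OpCalc

variable {d : ℕ} {Ω : Set (EuclideanSpace ℝ (Fin d))}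

/-! ### Elementary inequalities -/

theorem one_sub_exp_neg_le_sqrt {y : ℝ} (hy : 0 ≤ y) : 1 - Real.exp (-y) ≤ Real.sqrt y := by
  rcases le_total y 1 with h | h
  · have h1 := Real.add_one_le_exp (-y)
    have h2 : y ≤ Real.sqrt y := Real.le_sqrt_of_sq_le (by nlinarith)
    linarith
  · have h1 : 1 ≤ Real.sqrt y := Real.one_le_sqrt.mpr h
    linarith [Real.exp_pos (-y)]

theorem inv_sqrt_mul_one_sub_exp_le {y s : ℝ} (hy : 0 ≤ y) (hs : 0 ≤ s) :
    (Real.sqrt y)⁻¹ * (1 - Real.exp (-(s * y))) ≤ Real.sqrt s := by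
  rcases hy.eq_or_lt with rfl | hy
  · simp
  · rw [inv_mul_le_iff₀ (Real.sqrt_pos.mpr hy), ← Real.sqrt_mul hy.le, mul_comm y s]
    exact one_sub_exp_neg_le_sqrt (by positivity)

theorem inv_sqrt_mul_one_sub_exp_nonneg {y s : ℝ} (hy : 0 ≤ y) (hs : 0 ≤ s) :
    0 ≤ (Real.sqrt y)⁻¹ * (1 - Real.exp (-(s * y))) := by
  refine mul_nonneg (by positivity) (sub_nonneg.mpr (Real.exp_le_one_iff.mpr ?_))
  have := mul_nonneg hs hy
  linarith

/-! ### Facts on `L²(Ω)` -/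

theorem exists_seq_tendsto_ae_of_tendsto {v : ℕ → L2 Ω} {u : L2 Ω}
    (h : Tendsto v atTop (𝓝 u)) : ∃ ns : ℕ → ℕ, StrictMono ns ∧
      ∀ᵐ x ∂volume.restrict Ω, Tendsto (fun i => v (ns i) x) atTop (𝓝 (u x)) :=
  (tendstoInMeasure_of_tendsto_Lp h).exists_seq_tendsto_ae

theorem eLpNorm_le_of_tendsto {v : ℕ → L2 Ω} {u : L2 Ω} (h : Tendsto v atTop (𝓝 u))
    {q M : ℝ≥0∞} (hM : ∀ n, eLpNorm (v n) q (volume.restrict Ω) ≤ M) :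
    eLpNorm u q (volume.restrict Ω) ≤ M := by
  obtain ⟨ns, -, hns⟩ := exists_seq_tendsto_ae_of_tendsto h
  refine (Lp.eLpNorm_lim_le_liminf_eLpNorm (fun n => Lp.aestronglyMeasurable (v (ns n))) _ hns).trans
    ?_
  exact liminf_le_of_le (by isBoundedDefault) fun b hb =>
    let ⟨n, hn⟩ := hb.exists
    hn.trans (hM _)

theorem inner_eq_integral (f g : L2 Ω) : inner ℂ f g = ∫ x in Ω, g x * conj (f x) := by
  rw [L2.inner_def]
  rfl

theorem integrable_mul_conj (f g : L2 Ω) :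
    Integrable (fun x => g x * conj (f x)) (volume.restrict Ω) :=
  L2.integrable_inner f g

/-! ### Assumption A -/

/-- A self-adjoint operator with spectrum in `[-ω, ∞)` whose semigroup is bounded from `L²` to `L^q`
with norm at most `C t^{-α}` for `0 < t ≤ 1`, where `α < 1/2`: then `(1 + L)^{-1/2}` is bounded
from `L²` to `L^q`. -/
theorem exists_eLpNorm_inv_sqrt_le {L : L2 Ω →ₗ.[ℂ] L2 Ω} (hL : IsSelfAdjoint L) {ω : ℝ}
    (hω : ω < 1) (hS : ∀ x ∈ realSpec L, -ω ≤ x) {q : ℝ≥0∞} (hq : 1 ≤ q) {C α : ℝ} (hC : 0 < C)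
    (hα : α < 1 / 2)
    (h : ∀ t : ℝ, 0 < t → t ≤ 1 → ∀ f : L2 Ω,
      eLpNorm (boundedCalc L (fun x => (Real.exp (-t * x) : ℂ)) f) q (volume.restrict Ω) ≤
        ENNReal.ofReal (C * t ^ (-α) * ‖f‖)) :
    ∃ C' : ℝ, 0 < C' ∧ ∀ f : L2 Ω,
      eLpNorm (boundedCalc L (fun x => (((Real.sqrt (1 + x))⁻¹ : ℝ) : ℂ)) f) q (volume.restrict Ω) ≤
        ENNReal.ofReal (C' * ‖f‖) := by
  have hpos : ∀ x ∈ realSpec L, 0 < 1 + x := fun x hx => by linarith [hS x hx]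
  have hcρ : ContinuousOn (fun x => (Real.sqrt (1 + x))⁻¹) (realSpec L) :=
    ContinuousOn.inv₀ (by fun_prop) fun x hx => (Real.sqrt_pos.mpr (hpos x hx)).ne'
  have hρ : VanishesAtInfty L (fun x => (((Real.sqrt (1 + x))⁻¹ : ℝ) : ℂ)) := by
    refine vanishesAtInfty_of_tendsto_atTop hS hcρ (tendsto_inv_atTop_zero.comp ?_)
    exact Real.tendsto_sqrt_atTop.comp (tendsto_atTop_add_const_left _ _ tendsto_id)
  set ρ : ℝ → ℂ := fun x => (((Real.sqrt (1 + x))⁻¹ : ℝ) : ℂ) with hρd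
  have hbdd : ∀ s : ℝ, 0 ≤ s → ∀ x ∈ realSpec L, ‖(Real.exp (-(s * (1 + x))) : ℂ)‖ ≤ 1 := by
    intro s hs x hx
    rw [Complex.norm_real, Real.norm_of_nonneg (Real.exp_pos _).le, Real.exp_le_one_iff]
    have := mul_nonneg hs (hpos x hx).le
    linarith
  have hcont : ∀ s : ℝ, ContinuousOn (fun x : ℝ => (Real.exp (-(s * (1 + x))) : ℂ))
      (realSpec L) := fun s => Continuous.continuousOn (by fun_prop)
  have hE : ∀ s : ℝ, 0 ≤ s → VanishesAtInfty L (fun x => (Real.exp (-(s * (1 + x))) : ℂ) * ρ x) :=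
    fun s hs => .bdd_mul (hcont s) (hbdd s hs) hρ
  set s : ℕ → ℝ := fun n => (1 / 2) ^ n with hs
  have hs0 : ∀ n, 0 < s n := fun n => by positivity
  have hs1 : ∀ n, s n ≤ 1 := fun n => pow_le_one₀ (by norm_num) (by norm_num)
  set v : ℕ → L2 Ω →L[ℂ] L2 Ω := fun n =>
    boundedCalc L (fun x => (Real.exp (-(s n * (1 + x))) : ℂ) * ρ x) with hv
  -- the differences
  set r : ℝ := (1 / 2 : ℝ) ^ (1 / 2 - α) with hr
  have hr0 : 0 < r := by positivity
  have hr1 : r < 1 := Real.rpow_lt_one (by norm_num) (by norm_num) (by linarith)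
  have hdiff : ∀ n f, eLpNorm (v (n + 1) f - v n f : L2 Ω) q (volume.restrict Ω) ≤
      ENNReal.ofReal (C * r ^ (n + 1) * ‖f‖) := by
    intro n f
    set a := s (n + 1) with ha
    have ha0 : 0 < a := hs0 _
    have h2a : s n = 2 * a := by
      rw [ha, hs]; simp only [pow_succ]; ring
    set θ : ℝ → ℂ := fun x =>
      ((Real.exp (-a) * ((Real.sqrt (1 + x))⁻¹ * (1 - Real.exp (-(a * (1 + x))))) : ℝ) : ℂ) with hθd
    have hθb : ∀ x ∈ realSpec L, ‖θ x‖ ≤ Real.sqrt a := by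
      intro x hx
      have h1 := inv_sqrt_mul_one_sub_exp_nonneg (hpos x hx).le ha0.le
      rw [hθd, Complex.norm_real, Real.norm_of_nonneg (mul_nonneg (Real.exp_pos _).le h1)]
      refine (mul_le_of_le_one_left h1 (Real.exp_le_one_iff.mpr (by linarith))).trans ?_
      exact inv_sqrt_mul_one_sub_exp_le (hpos x hx).le ha0.le
    have hθ : VanishesAtInfty L θ := by
      refine (VanishesAtInfty.bdd_mul (φ := fun _ => (Real.exp (-a) : ℂ)) continuousOn_const
        (fun _ _ => le_rfl) (hρ.sub (hE a ha0.le))).congr fun x _ => ?_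
      simp only [hθd, hρd]
      push_cast
      ring
    have h1 : v (n + 1) f - v n f =
        boundedCalc L (fun x => (Real.exp (-a * x) : ℂ)) (boundedCalc L θ f) := by
      rw [← mul_apply_eq_comp, ← boundedCalc_mul hL (vanishesAtInfty_exp hS ha0) hθ,
        ← sub_apply, ← boundedCalc_sub hL (hE _ (hs0 _).le) (hE _ (hs0 _).le), h2a]
      congr 2
      funext x
      simp only [hθd, hρd, ← Complex.ofReal_mul, ← Complex.ofReal_sub]
      congr 1
      have e1 : Real.exp (-(2 * a * (1 + x))) =
          Real.exp (-a * x) * Real.exp (-a) * Real.exp (-(a * (1 + x))) := by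
        rw [← Real.exp_add, ← Real.exp_add]; ring_nf
      have e2 : Real.exp (-(a * (1 + x))) = Real.exp (-a * x) * Real.exp (-a) := by
        rw [← Real.exp_add]; ring_nf
      rw [e1]
      linear_combination (Real.sqrt (1 + x))⁻¹ * e2
    rw [h1]
    refine (h a ha0 (hs1 _) _).trans (ENNReal.ofReal_le_ofReal ?_)
    have h2 := norm_boundedCalc_apply_le hL (Real.sqrt_nonneg a) hθb f
    calc C * a ^ (-α) * ‖boundedCalc L θ f‖ ≤ C * a ^ (-α) * (Real.sqrt a * ‖f‖) := by gcongr
      _ = C * (a ^ (-α) * a ^ (1 / 2 : ℝ)) * ‖f‖ := by rw [Real.sqrt_eq_rpow]; ring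
      _ = C * r ^ (n + 1) * ‖f‖ := by
        rw [← Real.rpow_add ha0, hr, ← Real.rpow_natCast, ← Real.rpow_mul (by norm_num), ha, hs]
        simp only
        rw [← Real.rpow_natCast, ← Real.rpow_mul (by norm_num)]
        ring_nf
  obtain ⟨B, hB⟩ := hρ.exists_bound hL
  have hzero : ∀ f, eLpNorm (v 0 f : L2 Ω) q (volume.restrict Ω) ≤
      ENNReal.ofReal (C * |B| * ‖f‖) := by
    intro f
    have h1 : v 0 f = boundedCalc L (fun x => (Real.exp (-1 * x) : ℂ))
        (boundedCalc L (fun x => (Real.exp (-1) : ℂ) * ρ x) f) := by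
      rw [← mul_apply_eq_comp, ← boundedCalc_mul hL (vanishesAtInfty_exp hS one_pos)
        (.bdd_mul continuousOn_const (fun _ _ => le_rfl) hρ), hv]
      simp only
      congr 2
      funext x
      rw [← mul_assoc, ← Complex.ofReal_mul (Real.exp (-1 * x)), ← Real.exp_add]
      simp only [hs, pow_zero]
      ring_nf
    rw [h1]
    refine (h 1 one_pos le_rfl _).trans (ENNReal.ofReal_le_ofReal ?_)
    rw [Real.one_rpow, mul_one, mul_assoc]
    refine mul_le_mul_of_nonneg_left (norm_boundedCalc_apply_le hL (abs_nonneg B) ?_ f) hC.le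
    intro x hx
    rw [norm_mul, Complex.norm_real, Real.norm_of_nonneg (Real.exp_pos _).le]
    refine (mul_le_of_le_one_left (norm_nonneg _) (Real.exp_le_one_iff.mpr (by norm_num))).trans ?_
    exact (hB x hx).trans (le_abs_self B)
  have hpartial : ∀ n f, eLpNorm (v n f : L2 Ω) q (volume.restrict Ω) ≤
      ENNReal.ofReal (C * (|B| + ∑ k ∈ Finset.range n, r ^ (k + 1)) * ‖f‖) := by
    intro n f
    induction n with
    | zero => simpa using hzero f
    | succ n ih =>
      have h1 : ((v (n + 1) f : L2 Ω) : EuclideanSpace ℝ (Fin d) → ℂ) =ᵐ[volume.restrict Ω]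
          (v n f : L2 Ω) + (v (n + 1) f - v n f : L2 Ω) := by
        have := Lp.coeFn_add (v n f) (v (n + 1) f - v n f)
        rwa [add_sub_cancel] at this
      rw [eLpNorm_congr_ae h1]
      refine (eLpNorm_add_le (Lp.aestronglyMeasurable _) (Lp.aestronglyMeasurable _) hq).trans ?_
      refine (add_le_add ih (hdiff n f)).trans ?_
      have hsum : 0 ≤ ∑ k ∈ Finset.range n, r ^ (k + 1) :=
        Finset.sum_nonneg fun k _ => by positivity
      rw [← ENNReal.ofReal_add (by positivity) (by positivity), Finset.sum_range_succ]
      refine ENNReal.ofReal_le_ofReal (le_of_eq (by ring))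
  refine ⟨C * (|B| + r * (1 - r)⁻¹), ?_, fun f => ?_⟩
  · have : 0 < 1 - r := by linarith
    positivity
  · have hlim : Tendsto v atTop (𝓝 (boundedCalc L ρ)) := by
      refine tendsto_boundedCalc hL (fun n => hE _ (hs0 n).le) hρ ?_
      rw [Metric.tendstoUniformlyOn_iff]
      intro ε hε
      have h1 : Tendsto (fun n => Real.sqrt (s n)) atTop (𝓝 0) := by
        rw [← Real.sqrt_zero]
        exact (Real.continuous_sqrt.tendsto 0).comp
          (tendsto_pow_atTop_nhds_zero_of_lt_one (by norm_num) (by norm_num))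
      filter_upwards [h1.eventually_lt_const hε] with n hn x hx
      refine lt_of_le_of_lt ?_ hn
      have h2 : ρ x - (Real.exp (-(s n * (1 + x))) : ℂ) * ρ x =
          (((Real.sqrt (1 + x))⁻¹ * (1 - Real.exp (-(s n * (1 + x)))) : ℝ) : ℂ) := by
        simp only [hρd]
        push_cast
        ring
      rw [dist_eq_norm, h2, Complex.norm_real,
        Real.norm_of_nonneg (inv_sqrt_mul_one_sub_exp_nonneg (hpos x hx).le (hs0 n).le)]
      exact inv_sqrt_mul_one_sub_exp_le (hpos x hx).le (hs0 n).le
    refine eLpNorm_le_of_tendsto (tendsto_apply hlim f) fun n => (hpartial n f).trans ?_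
    refine ENNReal.ofReal_le_ofReal ?_
    gcongr
    simp only [pow_succ']
    rw [← Finset.mul_sum]
    gcongr
    rw [← tsum_geometric_of_lt_one hr0.le hr1]
    exact (summable_geometric_of_lt_one hr0.le hr1).sum_le_tsum _ fun k _ => by positivity

end SobolevOp

namespace SobolevOp

open OpCalc

variable {d : ℕ} {Ω : Set (EuclideanSpace ℝ (Fin d))}

theorem coe_add_one_lt_pStar {p : ℝ} (h : (p : EReal) < pStar d) :
    ((p + 1 : ℝ) : EReal) < pStar d + 1 := by
  unfold pStar at *
  split_ifs at * with h3
  · rw [EReal.coe_lt_coe_iff] at h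
    exact_mod_cast add_lt_add_left h 1
  · rw [EReal.top_add_of_ne_bot (by decide)]
    exact EReal.coe_lt_top _

theorem two_lt_pStar : ((2 : ℝ) : EReal) < pStar d + 1 := by
  have h : ((1 : ℝ) : EReal) < pStar d := by
    unfold pStar
    split_ifs with h3
    · rw [EReal.coe_lt_coe_iff]
      have : (3 : ℝ) ≤ d := by exact_mod_cast h3
      rw [one_lt_div (by linarith)]
      linarith
    · exact EReal.coe_lt_top _
  have := coe_add_one_lt_pStar h
  norm_num at this ⊢
  exact this

theorem exponent_lt_half {p : ℝ} (hp : 1 < p) (h : (p : EReal) < pStar d) :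
    (d : ℝ) / 2 * (1 / 2 - 1 / (p + 1)) < 1 / 2 := by
  have hp1 : 0 < p + 1 := by linarith
  have key : (d : ℝ) * (p - 1) < 2 * (p + 1) := by
    unfold pStar at h
    split_ifs at h with h3
    · have h3' : (3 : ℝ) ≤ d := by exact_mod_cast h3
      rw [EReal.coe_lt_coe_iff, lt_div_iff₀ (by linarith)] at h
      linarith
    · have : (d : ℝ) ≤ 2 := by exact_mod_cast (by omega : d ≤ 2)
      nlinarith
  have : (d : ℝ) / 2 * (1 / 2 - 1 / (p + 1)) = (d * (p - 1)) / (4 * (p + 1)) := by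
    field_simp
    ring
  rw [this, div_lt_iff₀ (by positivity)]
  linarith

theorem sobolev_of_assumptionA {L : L2 Ω →ₗ.[ℂ] L2 Ω} (hA : AssumptionA L) {p : ℝ} (hp : 1 < p)
    (hp' : (p : EReal) < pStar d) :
    ∃ C : ℝ, 0 < C ∧
      (∀ (F : testSpace ℕ L →ₛₗ[starRingEnd ℂ] ℂ) (h : L2 Ω), MemH1 L F h →
        ∃ u : EuclideanSpace ℝ (Fin d) → ℂ,
          MemLp u (ENNReal.ofReal (p + 1)) (volume.restrict Ω) ∧ IsFunction F u ∧
          eLpNorm u (ENNReal.ofReal (p + 1)) (volume.restrict Ω) ≤ ENNReal.ofReal (C * ‖h‖)) ∧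
      (∀ u h : L2 Ω, (u, h) ∈ (sqrtOneAdd L).graph →
        MemLp u (ENNReal.ofReal (p + 1)) (volume.restrict Ω) ∧
        eLpNorm u (ENNReal.ofReal (p + 1)) (volume.restrict Ω) ≤ ENNReal.ofReal (C * ‖h‖)) := by
  obtain ⟨hL, hA⟩ := hA
  obtain ⟨C₂, ω, hC₂, hω0, hω1, h2⟩ := hA 2 le_rfl two_lt_pStar
  have hS : ∀ x ∈ realSpec L, -ω ≤ x := by
    refine neg_le_of_mem_realSpec hL hC₂ fun t ht f => ?_
    obtain ⟨g, hg, hgn⟩ := h2 t ht f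
    refine ⟨g, hg, ?_⟩
    rw [sub_self, mul_zero, neg_zero, Real.rpow_zero, mul_one, ENNReal.ofReal_ofNat] at hgn
    rw [Lp.norm_def]
    exact ENNReal.toReal_le_of_le_ofReal (by positivity) hgn
  obtain ⟨C, ω', hC, hω0', hω1', hq⟩ := hA (p + 1) (by linarith) (coe_add_one_lt_pStar hp')
  have hq1 : 1 ≤ ENNReal.ofReal (p + 1) := by
    rw [ENNReal.one_le_ofReal]
    linarith
  obtain ⟨C', hC', hb⟩ := exists_eLpNorm_inv_sqrt_le hL hω1 hS hq1
    (C := C * Real.exp 1) (by positivity) (exponent_lt_half hp hp') (by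
      intro t ht ht1 f
      obtain ⟨g, hg, hgn⟩ := hq t ht f
      rw [eq_of_mem_graph_funCalc hL (vanishesAtInfty_exp hS ht) hg] at hgn
      refine hgn.trans (ENNReal.ofReal_le_ofReal ?_)
      have : Real.exp (ω' * t) ≤ Real.exp 1 := Real.exp_le_exp.mpr (by nlinarith)
      calc _ ≤ C * t ^ (-((d : ℝ) / 2 * (1 / 2 - 1 / (p + 1)))) * Real.exp 1 * ‖f‖ := by gcongr
        _ = _ := by ring)
  have hpos : ∀ x ∈ realSpec L, 0 < 1 + x := fun x hx => by linarith [hS x hx]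
  have hcρ : ContinuousOn (fun x => (Real.sqrt (1 + x))⁻¹) (realSpec L) :=
    ContinuousOn.inv₀ (by fun_prop) fun x hx => (Real.sqrt_pos.mpr (hpos x hx)).ne'
  have hρ : VanishesAtInfty L (fun x => (((Real.sqrt (1 + x))⁻¹ : ℝ) : ℂ)) := by
    refine vanishesAtInfty_of_tendsto_atTop hS hcρ (tendsto_inv_atTop_zero.comp ?_)
    exact Real.tendsto_sqrt_atTop.comp (tendsto_atTop_add_const_left _ _ tendsto_id)
  have hcs : ContinuousOn (fun x => Real.sqrt (1 + x)) (realSpec L) := by fun_prop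
  have hcs' : ContinuousOn (fun x => (Real.sqrt (1 + x) : ℂ)) (realSpec L) :=
    Complex.continuous_ofReal.comp_continuousOn hcs
  set T := boundedCalc L (fun x => (((Real.sqrt (1 + x))⁻¹ : ℝ) : ℂ)) with hT
  have hmem : ∀ h : L2 Ω, MemLp (T h) (ENNReal.ofReal (p + 1)) (volume.restrict Ω) := fun h =>
    ⟨Lp.aestronglyMeasurable _, (hb h).trans_lt ENNReal.ofReal_lt_top⟩
  refine ⟨C', hC', fun F h hF => ⟨T h, hmem h, fun g => ⟨integrable_mul_conj _ _, ?_⟩, hb h⟩,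
    fun u h hu => ?_⟩
  · have hg : (T g, (g : L2 Ω)) ∈ (sqrtOneAdd L).graph := by
      rw [sqrtOneAdd, mem_graph_funCalc]
      refine (tendsto_boundedCalc_cutoff hL (g : L2 Ω)).congr fun n => ?_
      rw [← mul_apply_eq_comp, ← boundedCalc_mul hL (vanishesAtInfty_mul_cutoff hcs' n) hρ]
      congr 1
      refine boundedCalc_congr hL fun x hx => ?_
      have := (Real.sqrt_pos.mpr (hpos x hx)).ne'
      simp only [← Complex.ofReal_mul]
      congr 1
      field_simp
    rw [hF.2 _ _ hg, ← inner_eq_integral, ← inner_eq_integral]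
    exact inner_boundedCalc_ofReal L _ _ _
  · have : T h = u := by
      refine tendsto_nhds_unique ?_ (tendsto_boundedCalc_cutoff hL u)
      refine (tendsto_boundedCalc_cutoff hL (T h)).congr fun n => ?_
      have h1 : VanishesAtInfty L
          (fun x => (cutoff n x : ℂ) * (((Real.sqrt (1 + x))⁻¹ : ℝ) : ℂ)) :=
        (vanishesAtInfty_cutoff L n).mul hL hρ
      have h2 : Set.EqOn (fun x => (cutoff n x : ℂ) * (((Real.sqrt (1 + x))⁻¹ : ℝ) : ℂ) *
          (Real.sqrt (1 + x) : ℂ)) (fun x => (cutoff n x : ℂ)) (realSpec L) := by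
        intro x hx
        have := (Real.sqrt_pos.mpr (hpos x hx)).ne'
        simp only [← Complex.ofReal_mul]
        congr 1
        field_simp
      rw [← mul_apply_eq_comp, ← boundedCalc_mul hL (vanishesAtInfty_cutoff L n) hρ,
        boundedCalc_apply_of_mem_graph hL hcs hu h1 ((vanishesAtInfty_cutoff L n).congr h2),
        boundedCalc_congr hL h2]
    rw [← this]
    exact ⟨hmem h, hb h⟩

end SobolevOp

namespace SobolevOp

open OpCalc

variable {d : ℕ} {Ω : Set (EuclideanSpace ℝ (Fin d))}

/-! ### Two-sided geometric sums -/

theorem summable_pow_natAbs {ρ : ℝ} (h0 : 0 ≤ ρ) (h1 : ρ < 1) :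
    Summable fun k : ℤ => ρ ^ k.natAbs := by
  have := summable_geometric_of_lt_one h0 h1
  exact .of_nat_of_neg (by simpa using this) (by simpa using this)

/-- Interpolation between increasing and decreasing geometric bounds. -/
theorem exists_sum_le_of_le_geometric {α β : ℝ} (hα : 0 < α) (hβ : 0 < β) :
    ∃ C : ℝ, 0 < C ∧ ∀ (a b : ℝ) (c : ℤ → ℝ), 0 ≤ a → 0 ≤ b →
      (∀ k : ℤ, c k ≤ a * (2 : ℝ) ^ (α * k)) → (∀ k : ℤ, c k ≤ b * (2 : ℝ) ^ (-(β * k))) →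
      ∀ s : Finset ℤ, ∑ k ∈ s, c k ≤ C * (a ^ (β / (α + β)) * b ^ (α / (α + β))) := by
  have hαβ : 0 < α + β := by positivity
  set γ := min α β with hγd
  have hγ : 0 < γ := lt_min hα hβ
  set ρ : ℝ := (2 : ℝ) ^ (-γ) with hρ
  have hρ0 : 0 < ρ := by positivity
  have hρ1 : ρ < 1 := Real.rpow_lt_one_of_one_lt_of_neg (by norm_num) (by linarith)
  have hsum := summable_pow_natAbs hρ0.le hρ1
  have hZ : 0 < ∑' k : ℤ, ρ ^ k.natAbs :=
    hsum.tsum_pos (fun k => by positivity) 0 (by positivity)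
  refine ⟨2 ^ β * ∑' k : ℤ, ρ ^ k.natAbs, by positivity, fun a b c ha hb h1 h2 s => ?_⟩
  rcases ha.eq_or_lt with rfl | ha
  · rw [Real.zero_rpow (by positivity), zero_mul, mul_zero]
    exact Finset.sum_nonpos fun k _ => (h1 k).trans_eq (zero_mul _)
  rcases hb.eq_or_lt with rfl | hb
  · rw [Real.zero_rpow (by positivity), mul_zero, mul_zero]
    exact Finset.sum_nonpos fun k _ => (h2 k).trans_eq (zero_mul _)
  set m := a ^ (β / (α + β)) * b ^ (α / (α + β)) with hm
  have hm0 : 0 < m := by positivity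
  set τ := Real.logb 2 (b / a) / (α + β) with hτ
  have hT : ∀ e : ℝ, (2 : ℝ) ^ (e * τ) = (b / a) ^ (e / (α + β)) := by
    intro e
    rw [hτ, ← mul_div_assoc, mul_comm e, mul_div_assoc, Real.rpow_mul (by norm_num),
      Real.rpow_logb (by norm_num) (by norm_num) (by positivity)]
  have hma : a * (2 : ℝ) ^ (α * τ) = m := by
    rw [hT, Real.div_rpow hb.le ha.le, hm]
    have h3 : a ^ (β / (α + β)) * a ^ (α / (α + β)) = a := by
      rw [← Real.rpow_add ha, ← add_div, add_comm β, div_self hαβ.ne', Real.rpow_one]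
    have h4 : a ^ (α / (α + β)) ≠ 0 := (Real.rpow_pos_of_pos ha _).ne'
    rw [mul_div_assoc', div_eq_iff h4, mul_right_comm, h3]
  have hmb : b * (2 : ℝ) ^ (-β * τ) = m := by
    have h3 : a * (2 : ℝ) ^ ((α + β) * τ) = b := by
      rw [hT, div_self hαβ.ne', Real.rpow_one, mul_div_cancel₀ _ ha.ne']
    rw [← h3, mul_assoc, ← Real.rpow_add (by norm_num), ← hma]
    ring_nf
  set K := ⌊τ⌋ with hK
  have hK1 : (K : ℝ) ≤ τ := Int.floor_le τ
  have hK2 : τ < K + 1 := Int.lt_floor_add_one τ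
  have hρpow : ∀ n : ℕ, ρ ^ n = (2 : ℝ) ^ (-γ * n) := fun n => by
    rw [hρ, ← Real.rpow_natCast, ← Real.rpow_mul (by norm_num)]
  have key : ∀ k : ℤ, c k ≤ 2 ^ β * m * ρ ^ (k - K).natAbs := by
    intro k
    rw [hρpow]
    rcases le_or_gt k K with hk | hk
    · have hn : ((k - K).natAbs : ℝ) = K - k := by
        rw [Nat.cast_natAbs, abs_of_nonpos (by omega)]
        push_cast
        ring
      have hk' : (0 : ℝ) ≤ K - k := by
        have : (k : ℝ) ≤ K := by exact_mod_cast hk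
        linarith
      refine (h1 k).trans ?_
      have h4 : a * (2 : ℝ) ^ (α * k) = m * 2 ^ (α * (k - τ)) := by
        rw [← hma, mul_assoc, ← Real.rpow_add (by norm_num)]
        ring_nf
      rw [h4, hn]
      have h5 : (2 : ℝ) ^ (α * (k - τ)) ≤ 2 ^ (-γ * (K - k)) := by
        refine Real.rpow_le_rpow_of_exponent_le (by norm_num) ?_
        nlinarith [min_le_left α β]
      have h6 : (1 : ℝ) ≤ 2 ^ β := Real.one_le_rpow (by norm_num) hβ.le
      calc m * 2 ^ (α * (k - τ)) ≤ m * 2 ^ (-γ * (K - k)) := by gcongr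
        _ = 1 * m * 2 ^ (-γ * (K - k)) := by ring
        _ ≤ _ := by gcongr
    · have hn : ((k - K).natAbs : ℝ) = k - K := by
        rw [Nat.cast_natAbs, abs_of_nonneg (by omega)]
        push_cast
        ring
      have hk' : (0 : ℝ) ≤ k - K := by
        have : (K : ℝ) < k := by exact_mod_cast hk
        linarith
      refine (h2 k).trans ?_
      have h4 : b * (2 : ℝ) ^ (-(β * k)) = m * 2 ^ (β * (τ - k)) := by
        rw [← hmb, mul_assoc, ← Real.rpow_add (by norm_num)]
        ring_nf
      rw [h4, hn]
      have h5 : (2 : ℝ) ^ (β * (τ - k)) ≤ 2 ^ (β + -γ * (k - K)) := by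
        refine Real.rpow_le_rpow_of_exponent_le (by norm_num) ?_
        nlinarith [min_le_right α β]
      calc m * 2 ^ (β * (τ - k)) ≤ m * 2 ^ (β + -γ * (k - K)) := by gcongr
        _ = _ := by rw [Real.rpow_add (by norm_num)]; ring
  refine (Finset.sum_le_sum fun k _ => key k).trans ?_
  rw [← Finset.mul_sum]
  have h7 : ∑ k ∈ s, ρ ^ (k - K).natAbs ≤ ∑' k : ℤ, ρ ^ k.natAbs := by
    rw [← (Equiv.subRight K).tsum_eq fun k : ℤ => ρ ^ k.natAbs]
    exact ((Equiv.subRight K).summable_iff.mpr hsum).sum_le_tsum _ fun k _ => by positivity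
  calc 2 ^ β * m * ∑ k ∈ s, ρ ^ (k - K).natAbs ≤ 2 ^ β * m * ∑' k : ℤ, ρ ^ k.natAbs := by gcongr
    _ = _ := by ring

/-! ### Gaussian kernels -/

theorem lintegral_exp_neg_mul_sq_norm {b : ℝ} (hb : 0 < b) :
    ∫⁻ z : EuclideanSpace ℝ (Fin d), ENNReal.ofReal (Real.exp (-b * ‖z‖ ^ 2)) =
      ENNReal.ofReal ((Real.pi / b) ^ ((d : ℝ) / 2)) := by
  have h1 := GaussianFourier.integral_rexp_neg_mul_sq_norm (V := EuclideanSpace ℝ (Fin d)) hb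
  rw [finrank_euclideanSpace_fin] at h1
  have h2 : Integrable fun z : EuclideanSpace ℝ (Fin d) => Real.exp (-b * ‖z‖ ^ 2) := by
    refine Integrable.of_integral_ne_zero ?_
    rw [h1]
    positivity
  rw [← h1, ofReal_integral_eq_lintegral_ofReal h2 (ae_of_all _ fun z => (Real.exp_pos _).le)]

theorem ae_norm_integral_le_of_gaussian_bound
    {K : EuclideanSpace ℝ (Fin d) → EuclideanSpace ℝ (Fin d) → ℂ} {A b : ℝ} (hA : 0 < A)
    (hb : 0 < b)
    (hK : ∀ᵐ z ∂((volume.restrict Ω).prod (volume.restrict Ω)),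
      ‖K z.1 z.2‖ ≤ A * Real.exp (-(‖z.1 - z.2‖ ^ 2 / b))) (f : L2 Ω) :
    ∀ᵐ x ∂volume.restrict Ω,
      ‖∫ y in Ω, K x y * f y‖ ≤ A * (Real.pi * b / 2) ^ ((d : ℝ) / 4) * ‖f‖ := by
  filter_upwards [Measure.ae_ae_of_ae_prod hK] with x hx
  set G : EuclideanSpace ℝ (Fin d) → ℝ≥0∞ := fun y =>
    ENNReal.ofReal (A * Real.exp (-(‖x - y‖ ^ 2 / b))) with hG
  have hf : AEMeasurable (fun y => ‖f y‖ₑ) (volume.restrict Ω) :=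
    (Lp.aestronglyMeasurable f).enorm
  have h1 : ‖∫ y in Ω, K x y * f y‖ₑ ≤ ∫⁻ y in Ω, (G * fun y => ‖f y‖ₑ) y := by
    refine (enorm_integral_le_lintegral_enorm _).trans (lintegral_mono_ae ?_)
    filter_upwards [hx] with y hy
    rw [Pi.mul_apply, enorm_mul]
    gcongr
    rw [← ofReal_norm]
    exact ENNReal.ofReal_le_ofReal hy
  have hGm : Measurable G := by
    rw [hG]
    fun_prop
  have h2 := ENNReal.lintegral_mul_le_Lp_mul_Lq (volume.restrict Ω)
    (p := 2) (q := 2) (by rw [Real.holderConjugate_iff]; norm_num) hGm.aemeasurable hf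
  have h3 : ∫⁻ y in Ω, G y ^ (2 : ℝ) ≤
      ENNReal.ofReal ((A * (Real.pi * b / 2) ^ ((d : ℝ) / 4)) ^ (2 : ℝ)) := by
    refine (setLIntegral_le_lintegral _ _).trans (le_of_eq ?_)
    have h4 : ∀ y, G y ^ (2 : ℝ) =
        ENNReal.ofReal (A ^ 2) * ENNReal.ofReal (Real.exp (-(2 / b) * ‖x - y‖ ^ 2)) := by
      intro y
      rw [hG, ENNReal.ofReal_rpow_of_nonneg (by positivity) (by norm_num),
        ← ENNReal.ofReal_mul (by positivity), Real.rpow_two, mul_pow, ← Real.exp_nat_mul]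
      congr 3
      push_cast
      ring
    simp only [h4]
    rw [lintegral_const_mul _ (by fun_prop),
      lintegral_sub_left_eq_self
        (fun z => ENNReal.ofReal (Real.exp (-(2 / b) * ‖z‖ ^ 2))) x,
      lintegral_exp_neg_mul_sq_norm (by positivity), ← ENNReal.ofReal_mul (by positivity),
      Real.rpow_two, mul_pow]
    congr 2
    rw [← Real.rpow_natCast, ← Real.rpow_mul (by positivity)]
    congr 1
    · field_simp
    · push_cast
      ring
  have h5 : (∫⁻ y in Ω, ‖f y‖ₑ ^ (2 : ℝ)) ^ (1 / (2 : ℝ)) = ENNReal.ofReal ‖f‖ := by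
    rw [Lp.norm_def, ENNReal.ofReal_toReal (Lp.eLpNorm_ne_top f),
      eLpNorm_eq_lintegral_rpow_enorm_toReal (by norm_num) (by norm_num)]
    simp
  have h6 : ‖∫ y in Ω, K x y * f y‖ₑ ≤
      ENNReal.ofReal (A * (Real.pi * b / 2) ^ ((d : ℝ) / 4) * ‖f‖) := by
    refine h1.trans (h2.trans ?_)
    rw [h5, ENNReal.ofReal_mul (by positivity)]
    gcongr
    refine (ENNReal.rpow_le_rpow h3 (by norm_num)).trans_eq ?_
    rw [ENNReal.ofReal_rpow_of_nonneg (by positivity) (by norm_num),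
      ← Real.rpow_mul (by positivity)]
    norm_num
  rw [← ofReal_norm] at h6
  exact (ENNReal.ofReal_le_ofReal_iff (by positivity)).mp h6

/-- Assumption B implies that `e^{-tL}` is bounded from `L²` to `L^∞` with norm at most
`C t^{-d/4}`. -/
theorem AssumptionB.exists_ultracontractive {L : L2 Ω →ₗ.[ℂ] L2 Ω} (hB : AssumptionB L)
    (hS : ∀ x ∈ realSpec L, 0 ≤ x) :
    ∃ C : ℝ, 0 < C ∧ ∀ t : ℝ, 0 < t → ∀ f : L2 Ω, ∀ᵐ x ∂volume.restrict Ω,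
      ‖boundedCalc L (fun x => (Real.exp (-t * x) : ℂ)) f x‖ ≤ C * t ^ (-((d : ℝ) / 4)) * ‖f‖ := by
  obtain ⟨hL, -, c, C, hc, hC, K, hK⟩ := hB
  refine ⟨C * (Real.pi * c / 2) ^ ((d : ℝ) / 4), by positivity, fun t ht f => ?_⟩
  obtain ⟨-, hKb, hKf⟩ := hK t ht
  obtain ⟨g, hg, hgx⟩ := hKf f
  rw [eq_of_mem_graph_funCalc hL (vanishesAtInfty_exp hS ht) hg] at hgx
  filter_upwards [hgx, ae_norm_integral_le_of_gaussian_bound (by positivity) (by positivity) hKb f]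
    with x hx hx'
  rw [hx]
  refine hx'.trans_eq ?_
  have h1 : Real.pi * (c * t) / 2 = (Real.pi * c / 2) * t := by ring
  have h2 : t ^ (-((d : ℝ) / 4)) = t ^ (-((d : ℝ) / 2)) * t ^ ((d : ℝ) / 4) := by
    rw [← Real.rpow_add ht]
    ring_nf
  rw [h1, Real.mul_rpow (by positivity) ht.le, h2]
  ring

end SobolevOp

namespace SobolevOp

open OpCalc

/-! ### Dyadic decomposition of `L^{-1/2}` -/

/-- `x^{-1/2} (1 - e^{-tx})`. -/
def invSqrtIncr (t x : ℝ) : ℝ := (Real.sqrt x)⁻¹ * (1 - Real.exp (-(t * x)))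

/-- `x^{-1/2} (e^{-tx} - e^{-2tx})`. -/
def dyadicFun (t x : ℝ) : ℝ := Real.exp (-t * x) * invSqrtIncr t x

theorem invSqrtIncr_nonneg {t x : ℝ} (ht : 0 ≤ t) (hx : 0 ≤ x) : 0 ≤ invSqrtIncr t x :=
  inv_sqrt_mul_one_sub_exp_nonneg hx ht

theorem invSqrtIncr_le {t x : ℝ} (ht : 0 ≤ t) (hx : 0 ≤ x) : invSqrtIncr t x ≤ Real.sqrt t :=
  inv_sqrt_mul_one_sub_exp_le hx ht

theorem invSqrtIncr_le_inv_sqrt (t x : ℝ) : invSqrtIncr t x ≤ (Real.sqrt x)⁻¹ := by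
  refine mul_le_of_le_one_right (by positivity) ?_
  linarith [Real.exp_pos (-(t * x))]

theorem invSqrtIncr_le_mul_sqrt {t x : ℝ} (hx : 0 ≤ x) :
    invSqrtIncr t x ≤ t * Real.sqrt x := by
  rcases hx.eq_or_lt with rfl | hx
  · simp [invSqrtIncr]
  · rw [invSqrtIncr, inv_mul_le_iff₀ (Real.sqrt_pos.mpr hx), mul_left_comm,
      Real.mul_self_sqrt hx.le]
    linarith [Real.add_one_le_exp (-(t * x))]

theorem continuousOn_invSqrtIncr {t : ℝ} (ht : 0 ≤ t) :
    ContinuousOn (invSqrtIncr t) (Set.Ici 0) := by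
  intro x hx
  rcases (Set.mem_Ici.mp hx).eq_or_lt with rfl | hx
  · have h0 : invSqrtIncr t 0 = 0 := by simp [invSqrtIncr]
    rw [ContinuousWithinAt, h0]
    have h1 : Tendsto (fun x => t * Real.sqrt x) (𝓝[Set.Ici 0] 0) (𝓝 (t * Real.sqrt 0)) :=
      ((Real.continuous_sqrt.const_mul t).tendsto 0).mono_left nhdsWithin_le_nhds
    rw [Real.sqrt_zero, mul_zero] at h1
    refine squeeze_zero' ?_ ?_ h1
    · filter_upwards [self_mem_nhdsWithin] with y hy using invSqrtIncr_nonneg ht hy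
    · filter_upwards [self_mem_nhdsWithin] with y hy using invSqrtIncr_le_mul_sqrt hy
  · refine ContinuousAt.continuousWithinAt (ContinuousAt.mul ?_ (by fun_prop))
    exact Real.continuous_sqrt.continuousAt.inv₀ (Real.sqrt_pos.mpr hx).ne'

/-- The dyadic pieces telescope. -/
theorem sum_dyadicFun_mul_sqrt {x : ℝ} (hx : 0 ≤ x) (N : ℕ) :
    (∑ k ∈ Finset.Ico (-N : ℤ) N, dyadicFun ((2 : ℝ) ^ k) x) * Real.sqrt x =
      Real.exp (-((2 : ℝ) ^ (-N : ℤ)) * x) - Real.exp (-((2 : ℝ) ^ (N : ℤ)) * x) := by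
  rcases hx.eq_or_lt with rfl | hx
  · simp
  have h0 : Real.sqrt x ≠ 0 := (Real.sqrt_pos.mpr hx).ne'
  have h1 : ∀ k : ℤ, dyadicFun ((2 : ℝ) ^ k) x * Real.sqrt x =
      Real.exp (-((2 : ℝ) ^ k) * x) - Real.exp (-((2 : ℝ) ^ (k + 1)) * x) := by
    intro k
    have h2 : Real.exp (-((2 : ℝ) ^ (k + 1)) * x) =
        Real.exp (-((2 : ℝ) ^ k) * x) * Real.exp (-((2 : ℝ) ^ k * x)) := by
      rw [← Real.exp_add, zpow_add_one₀ (by norm_num)]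
      ring_nf
    rw [dyadicFun, invSqrtIncr, h2]
    field_simp
  rw [Finset.sum_mul, Finset.sum_congr rfl fun k _ => h1 k]
  induction N with
  | zero => simp
  | succ N ih =>
    have h3 : Finset.Ico (-((N + 1 : ℕ) : ℤ)) ((N + 1 : ℕ) : ℤ) =
        insert (-((N + 1 : ℕ) : ℤ)) (insert (N : ℤ) (Finset.Ico (-N : ℤ) N)) := by
      ext k
      simp only [Finset.mem_Ico, Finset.mem_insert]
      omega
    rw [h3, Finset.sum_insert (by simp), Finset.sum_insert (by simp), ih]
    have h4 : (-((N + 1 : ℕ) : ℤ)) + 1 = -(N : ℤ) := by push_cast; ring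
    rw [h4]
    push_cast
    ring

theorem exists_sum_sq_dyadicFun_le :
    ∃ C : ℝ, 0 < C ∧ ∀ x : ℝ, 0 ≤ x → ∀ s : Finset ℤ,
      ∑ k ∈ s, (2 : ℝ) ^ (-k) * dyadicFun ((2 : ℝ) ^ k) x ^ 2 ≤ C := by
  obtain ⟨C, hC, h⟩ := exists_sum_le_of_le_geometric one_pos one_pos
  refine ⟨C, hC, fun x hx s => ?_⟩
  rcases hx.eq_or_lt with rfl | hx
  · simpa [dyadicFun, invSqrtIncr] using hC.le
  have hpow : ∀ k : ℤ, (0 : ℝ) < (2 : ℝ) ^ k := fun k => by positivity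
  have hnn : ∀ k : ℤ, 0 ≤ dyadicFun ((2 : ℝ) ^ k) x := fun k =>
    mul_nonneg (Real.exp_pos _).le (invSqrtIncr_nonneg (hpow k).le hx.le)
  have hle : ∀ k : ℤ, dyadicFun ((2 : ℝ) ^ k) x ≤ invSqrtIncr ((2 : ℝ) ^ k) x := fun k => by
    refine mul_le_of_le_one_left (invSqrtIncr_nonneg (hpow k).le hx.le)
      (Real.exp_le_one_iff.mpr ?_)
    have := mul_pos (hpow k) hx
    linarith
  have h2 := h x x⁻¹ (fun k => (2 : ℝ) ^ (-k) * dyadicFun ((2 : ℝ) ^ k) x ^ 2) hx.le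
    (inv_pos.mpr hx).le (fun k => ?_) (fun k => ?_) s
  · refine h2.trans_eq ?_
    rw [← Real.mul_rpow hx.le (by positivity), mul_inv_cancel₀ hx.ne', Real.one_rpow, mul_one]
  · rw [one_mul, Real.rpow_intCast]
    have h3 : dyadicFun ((2 : ℝ) ^ k) x ^ 2 ≤ ((2 : ℝ) ^ k * Real.sqrt x) ^ 2 :=
      pow_le_pow_left₀ (hnn k) ((hle k).trans (invSqrtIncr_le_mul_sqrt hx.le)) 2
    rw [mul_pow, Real.sq_sqrt hx.le] at h3
    rw [zpow_neg, inv_mul_le_iff₀ (hpow k)]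
    linarith
  · rw [one_mul, Real.rpow_neg (by norm_num), Real.rpow_intCast, ← zpow_neg, mul_comm]
    have h3 : dyadicFun ((2 : ℝ) ^ k) x ^ 2 ≤ ((Real.sqrt x)⁻¹) ^ 2 :=
      pow_le_pow_left₀ (hnn k) ((hle k).trans (invSqrtIncr_le_inv_sqrt _ x)) 2
    rw [inv_pow, Real.sq_sqrt hx.le] at h3
    gcongr

section Hilbert

variable {H : Type*} [NormedAddCommGroup H] [InnerProductSpace ℂ H] [CompleteSpace H]

theorem vanishesAtInfty_invSqrtIncr {L : H →ₗ.[ℂ] H} (hS : ∀ x ∈ realSpec L, 0 ≤ x) {t : ℝ}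
    (ht : 0 ≤ t) : VanishesAtInfty L (fun x => (invSqrtIncr t x : ℂ)) := by
  refine vanishesAtInfty_of_tendsto_atTop hS ((continuousOn_invSqrtIncr ht).mono hS) ?_
  refine squeeze_zero' ?_ (Eventually.of_forall (invSqrtIncr_le_inv_sqrt t))
    (tendsto_inv_atTop_zero.comp Real.tendsto_sqrt_atTop)
  filter_upwards [eventually_ge_atTop 0] with x hx using invSqrtIncr_nonneg ht hx

theorem vanishesAtInfty_dyadicFun {L : H →ₗ.[ℂ] H} (hL : IsSelfAdjoint L)
    (hS : ∀ x ∈ realSpec L, 0 ≤ x) {t : ℝ} (ht : 0 < t) :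
    VanishesAtInfty L (fun x => (dyadicFun t x : ℂ)) := by
  simp only [dyadicFun, Complex.ofReal_mul]
  exact (vanishesAtInfty_exp hS ht).mul hL (vanishesAtInfty_invSqrtIncr hS ht.le)

/-- The dyadic piece `L^{-1/2} (e^{-tL} - e^{-2tL})`, `t = 2^k`, of `L^{-1/2}`. -/
def dyadicPiece (L : H →ₗ.[ℂ] H) (k : ℤ) : H →L[ℂ] H :=
  boundedCalc L (fun x => (dyadicFun ((2 : ℝ) ^ k) x : ℂ))

theorem dyadicPiece_apply {L : H →ₗ.[ℂ] H} (hL : IsSelfAdjoint L)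
    (hS : ∀ x ∈ realSpec L, 0 ≤ x) (k : ℤ) (h : H) :
    dyadicPiece L k h = boundedCalc L (fun x => (Real.exp (-((2 : ℝ) ^ k) * x) : ℂ))
      (boundedCalc L (fun x => (invSqrtIncr ((2 : ℝ) ^ k) x : ℂ)) h) := by
  have ht : (0 : ℝ) < 2 ^ k := by positivity
  rw [← mul_apply_eq_comp, ← boundedCalc_mul hL (vanishesAtInfty_exp hS ht)
    (vanishesAtInfty_invSqrtIncr hS ht.le), dyadicPiece]
  simp only [dyadicFun, Complex.ofReal_mul]

/-- The square function estimate. -/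
theorem exists_sum_norm_sq_dyadicPiece_le :
    ∃ C : ℝ, 0 < C ∧ ∀ (H : Type*) [NormedAddCommGroup H] [InnerProductSpace ℂ H]
      [CompleteSpace H] (L : H →ₗ.[ℂ] H), IsSelfAdjoint L → (∀ x ∈ realSpec L, 0 ≤ x) →
      ∀ (h : H) (s : Finset ℤ),
        ∑ k ∈ s, (2 : ℝ) ^ (-k) * ‖dyadicPiece L k h‖ ^ 2 ≤ C * ‖h‖ ^ 2 := by
  obtain ⟨C, hC, hsum⟩ := exists_sum_sq_dyadicFun_le
  refine ⟨C, hC, fun H _ _ _ L hL hS h s => ?_⟩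
  have hv : ∀ k : ℤ, VanishesAtInfty L (fun x => (dyadicFun ((2 : ℝ) ^ k) x : ℂ)) := fun k =>
    vanishesAtInfty_dyadicFun hL hS (by positivity)
  have hv2 : ∀ k ∈ s, VanishesAtInfty L (fun x => (((2 : ℝ) ^ (-k) : ℝ) : ℂ) *
      ((dyadicFun ((2 : ℝ) ^ k) x : ℂ) * (dyadicFun ((2 : ℝ) ^ k) x : ℂ))) := fun k _ =>
    .bdd_mul continuousOn_const (fun _ _ => le_rfl) ((hv k).mul hL (hv k))
  have h1 : ∀ k, inner ℂ h (boundedCalc L (fun x => (((2 : ℝ) ^ (-k) : ℝ) : ℂ) *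
      ((dyadicFun ((2 : ℝ) ^ k) x : ℂ) * (dyadicFun ((2 : ℝ) ^ k) x : ℂ))) h) =
        (((2 : ℝ) ^ (-k) * ‖dyadicPiece L k h‖ ^ 2 : ℝ) : ℂ) := by
    intro k
    rw [boundedCalc_const_mul hL _ ((hv k).mul hL (hv k)), boundedCalc_mul hL (hv k) (hv k),
      smul_apply, mul_apply_eq_comp, inner_smul_right, ← inner_boundedCalc_ofReal, ← dyadicPiece,
      inner_self_eq_norm_sq_to_K]
    push_cast
    rfl
  have h2 : ((∑ k ∈ s, (2 : ℝ) ^ (-k) * ‖dyadicPiece L k h‖ ^ 2 : ℝ) : ℂ) =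
      inner ℂ h (boundedCalc L (fun x => ∑ k ∈ s, (((2 : ℝ) ^ (-k) : ℝ) : ℂ) *
      ((dyadicFun ((2 : ℝ) ^ k) x : ℂ) * (dyadicFun ((2 : ℝ) ^ k) x : ℂ))) h) := by
    rw [boundedCalc_sum hL s hv2, sum_apply, inner_sum, Complex.ofReal_sum]
    exact Finset.sum_congr rfl fun k _ => (h1 k).symm
  have hnn : 0 ≤ ∑ k ∈ s, (2 : ℝ) ^ (-k) * ‖dyadicPiece L k h‖ ^ 2 :=
    Finset.sum_nonneg fun k _ => by positivity
  rw [← Real.norm_of_nonneg hnn, ← Complex.norm_real, h2]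
  refine (norm_inner_le_norm _ _).trans ?_
  rw [sq, mul_left_comm]
  refine mul_le_mul_of_nonneg_left (norm_boundedCalc_apply_le hL hC.le (fun x hx => ?_) h)
    (norm_nonneg h)
  have h3 : ∑ k ∈ s, (((2 : ℝ) ^ (-k) : ℝ) : ℂ) *
      ((dyadicFun ((2 : ℝ) ^ k) x : ℂ) * (dyadicFun ((2 : ℝ) ^ k) x : ℂ)) =
      ((∑ k ∈ s, (2 : ℝ) ^ (-k) * dyadicFun ((2 : ℝ) ^ k) x ^ 2 : ℝ) : ℂ) := by
    push_cast
    exact Finset.sum_congr rfl fun k _ => by ring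
  rw [h3, Complex.norm_real, Real.norm_of_nonneg (Finset.sum_nonneg fun k _ => by positivity)]
  exact hsum x (hS x hx) s

theorem sum_dyadicPiece_apply {L : H →ₗ.[ℂ] H} (hL : IsSelfAdjoint L)
    (hS : ∀ x ∈ realSpec L, 0 ≤ x) {w g : H} (hw : (w, g) ∈ (sqrtOp L).graph) (N : ℕ) :
    ∑ k ∈ Finset.Ico (-N : ℤ) N, dyadicPiece L k g =
      boundedCalc L (fun x => (Real.exp (-((2 : ℝ) ^ (-N : ℤ)) * x) : ℂ)) w -
        boundedCalc L (fun x => (Real.exp (-((2 : ℝ) ^ (N : ℤ)) * x) : ℂ)) w := by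
  have hv : ∀ k ∈ Finset.Ico (-N : ℤ) N,
      VanishesAtInfty L (fun x => (dyadicFun ((2 : ℝ) ^ k) x : ℂ)) := fun k _ =>
    vanishesAtInfty_dyadicFun hL hS (by positivity)
  have he : ∀ k : ℤ, VanishesAtInfty L (fun x => (Real.exp (-((2 : ℝ) ^ k) * x) : ℂ)) := fun k =>
    vanishesAtInfty_exp hS (by positivity)
  have h1 : Set.EqOn
      (fun x => (∑ k ∈ Finset.Ico (-N : ℤ) N, (dyadicFun ((2 : ℝ) ^ k) x : ℂ)) * (Real.sqrt x : ℂ))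
      (fun x => (Real.exp (-((2 : ℝ) ^ (-N : ℤ)) * x) : ℂ) -
        (Real.exp (-((2 : ℝ) ^ (N : ℤ)) * x) : ℂ)) (realSpec L) := by
    intro x hx
    simp only
    rw [← Complex.ofReal_sum, ← Complex.ofReal_mul, sum_dyadicFun_mul_sqrt (hS x hx),
      Complex.ofReal_sub]
  rw [← sub_apply, ← boundedCalc_sub hL (he _) (he _), ← boundedCalc_congr hL h1,
    ← boundedCalc_apply_of_mem_graph hL Real.continuous_sqrt.continuousOn hw (.sum _ hv)
      (((he _).sub (he _)).congr h1), boundedCalc_sum hL _ hv, sum_apply]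
  rfl

theorem tendsto_exp_apply_self {L : H →ₗ.[ℂ] H} (hL : IsSelfAdjoint L)
    (hS : ∀ x ∈ realSpec L, 0 ≤ x) (w : H) :
    Tendsto (fun N : ℕ => boundedCalc L (fun x => (Real.exp (-((2 : ℝ) ^ (-N : ℤ)) * x) : ℂ)) w)
      atTop (𝓝 w) := by
  refine tendsto_boundedCalc_apply_self hL
    (φ := fun (N : ℕ) x => (Real.exp (-((2 : ℝ) ^ (-N : ℤ)) * x) : ℂ))
    (fun N => vanishesAtInfty_exp hS (by positivity)) (fun N x hx => ?_) ?_ w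
  · rw [Complex.norm_real, Real.norm_of_nonneg (Real.exp_pos _).le, Real.exp_le_one_iff, neg_mul]
    exact neg_nonpos.mpr (mul_nonneg (by positivity) (hS x hx))
  · rw [Metric.tendstoUniformlyOn_iff]
    intro ε hε
    have h1 : Tendsto (fun N : ℕ => (2 : ℝ) ^ (-N : ℤ)) atTop (𝓝 0) := by
      have := tendsto_pow_atTop_nhds_zero_of_lt_one (r := (1 / 2 : ℝ)) (by norm_num) (by norm_num)
      refine this.congr fun N => ?_
      rw [zpow_neg, zpow_natCast, one_div, inv_pow]
    filter_upwards [h1.eventually_lt_const hε] with N hN x hx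
    refine lt_of_le_of_lt ?_ hN
    set t := (2 : ℝ) ^ (-N : ℤ) with ht
    have ht0 : 0 < t := by positivity
    rw [dist_eq_norm, ← one_sub_mul, norm_mul, norm_inv, ← Complex.ofReal_one,
      ← Complex.ofReal_sub, Complex.norm_real, ← div_eq_mul_inv,
      div_le_iff₀ (norm_pos_iff.mpr (ofReal_add_I_ne_zero x))]
    have h2 : x ≤ ‖(x : ℂ) + Complex.I‖ := by
      refine (le_abs_self x).trans ?_
      simpa using Complex.abs_re_le_norm ((x : ℂ) + Complex.I)
    have h3 := Real.add_one_le_exp (-t * x)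
    have h4 : Real.exp (-t * x) ≤ 1 := Real.exp_le_one_iff.mpr (by nlinarith [hS x hx])
    rw [Real.norm_of_nonneg (by linarith)]
    nlinarith

theorem tendsto_exp_apply_zero {L : H →ₗ.[ℂ] H} (hL : IsSelfAdjoint L)
    (hS : ∀ x ∈ realSpec L, 0 ≤ x) {w g : H} (hw : (g, w) ∈ (sqrtOp L).graph) :
    Tendsto (fun N : ℕ => boundedCalc L (fun x => (Real.exp (-((2 : ℝ) ^ (N : ℤ)) * x) : ℂ)) w)
      atTop (𝓝 0) := by
  have key : ∀ t x : ℝ, 0 < t → 0 ≤ x →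
      Real.exp (-t * x) * Real.sqrt x ≤ (Real.sqrt t)⁻¹ := by
    intro t x ht hx
    rw [← mul_one (Real.sqrt t)⁻¹, le_inv_mul_iff₀ (Real.sqrt_pos.mpr ht), mul_left_comm,
      ← Real.sqrt_mul ht.le, neg_mul, Real.exp_neg, inv_mul_le_iff₀ (Real.exp_pos _), mul_one]
    have h1 := Real.add_one_le_exp (t * x)
    have h2 : 0 ≤ t * x := by positivity
    have h3 : Real.sqrt (t * x) ≤ t * x + 1 := Real.sqrt_le_iff.mpr ⟨by linarith, by nlinarith⟩
    linarith
  have hnn : ∀ t x : ℝ, ‖(Real.exp (-t * x) : ℂ) * (Real.sqrt x : ℂ)‖ =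
      Real.exp (-t * x) * Real.sqrt x := fun t x => by
    rw [← Complex.ofReal_mul, Complex.norm_real, Real.norm_of_nonneg (by positivity)]
  have hv : ∀ t : ℝ, 0 < t →
      VanishesAtInfty L (fun x => (Real.exp (-t * x) : ℂ) * (Real.sqrt x : ℂ)) := by
    intro t ht
    have h1 : VanishesAtInfty L
        (fun x => ((Real.exp (-(t / 2) * x) * Real.sqrt x : ℝ) : ℂ) *
          (Real.exp (-(t / 2) * x) : ℂ)) := by
      refine .bdd_mul (B := (Real.sqrt (t / 2))⁻¹) (Continuous.continuousOn (by fun_prop))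
        (fun x hx => ?_) (vanishesAtInfty_exp hS (half_pos ht))
      rw [Complex.norm_real, Real.norm_of_nonneg (by positivity)]
      exact key _ x (half_pos ht) (hS x hx)
    refine h1.congr fun x _ => ?_
    simp only [← Complex.ofReal_mul]
    congr 1
    rw [mul_right_comm, ← Real.exp_add]
    ring_nf
  have h1 : Tendsto (fun N : ℕ => (Real.sqrt ((2 : ℝ) ^ (N : ℤ)))⁻¹ * ‖g‖) atTop (𝓝 0) := by
    rw [← zero_mul ‖g‖]
    refine Tendsto.mul_const _ (tendsto_inv_atTop_zero.comp (Real.tendsto_sqrt_atTop.comp ?_))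
    simpa only [zpow_natCast] using tendsto_pow_atTop_atTop_of_one_lt (r := (2 : ℝ)) (by norm_num)
  refine squeeze_zero_norm (fun N => ?_) h1
  have ht : (0 : ℝ) < 2 ^ (N : ℤ) := by positivity
  rw [boundedCalc_apply_of_mem_graph hL Real.continuous_sqrt.continuousOn hw
    (vanishesAtInfty_exp hS ht) (hv _ ht)]
  refine norm_boundedCalc_apply_le hL (by positivity) (fun x hx => ?_) g
  rw [hnn]
  exact key _ x ht (hS x hx)

/-- `L = L^{1/2} L^{1/2}`. -/
theorem exists_sqrtOp_graph {L : H →ₗ.[ℂ] H} (hL : IsSelfAdjoint L)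
    (hS : ∀ x ∈ realSpec L, 0 ≤ x) {f g : H} (h : (f, g) ∈ L.graph) :
    ∃ w, (f, w) ∈ (sqrtOp L).graph ∧ (w, g) ∈ (sqrtOp L).graph := by
  set y := g + Complex.I • f with hy
  have hf : resolvent L y = f := resolvent_apply_of_mem_graph hL h
  set τ : ℝ → ℂ := fun x => (Real.sqrt x : ℂ) * ((x : ℂ) + Complex.I)⁻¹ with hτ
  have hcs : ContinuousOn (fun x => (Real.sqrt x : ℂ)) (realSpec L) :=
    Continuous.continuousOn (by fun_prop)
  have hτv : VanishesAtInfty L τ := by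
    refine vanishesAtInfty_of_tendsto_atTop_complex hS
      (hcs.mul (vanishesAtInfty_inv L).continuousOn) ?_
    refine squeeze_zero_norm' ?_ (tendsto_inv_atTop_zero.comp Real.tendsto_sqrt_atTop)
    filter_upwards [eventually_gt_atTop 0] with x hx
    have h2 : x ≤ ‖(x : ℂ) + Complex.I‖ := by
      refine (le_abs_self x).trans ?_
      simpa using Complex.abs_re_le_norm ((x : ℂ) + Complex.I)
    rw [hτ, norm_mul, norm_inv, Complex.norm_real, Real.norm_of_nonneg (Real.sqrt_nonneg x),
      ← div_eq_mul_inv, Function.comp_apply, div_le_iff₀ (hx.trans_le h2),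
      le_inv_mul_iff₀ (Real.sqrt_pos.mpr hx), Real.mul_self_sqrt hx.le]
    exact h2
  refine ⟨boundedCalc L τ y, ?_, ?_⟩
  · rw [sqrtOp, mem_graph_funCalc]
    refine (tendsto_apply (tendsto_boundedCalc_mul_cutoff hL hτv) y).congr fun n => ?_
    rw [← hf, ← boundedCalc_inv hL, ← mul_apply_eq_comp,
      ← boundedCalc_mul hL (vanishesAtInfty_mul_cutoff hcs n) (vanishesAtInfty_inv L)]
    simp only [hτ, mul_right_comm]
  · have hg : g = y - Complex.I • resolvent L y := by rw [hf, hy, add_sub_cancel_right]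
    rw [sqrtOp, mem_graph_funCalc, hg]
    refine (tendsto_boundedCalc_cutoff hL _).congr fun n => ?_
    have hc := vanishesAtInfty_cutoff L n
    have hci := hc.mul hL (vanishesAtInfty_inv L)
    rw [← mul_apply_eq_comp, ← boundedCalc_mul hL (vanishesAtInfty_mul_cutoff hcs n) hτv, map_sub,
      map_smul, ← boundedCalc_inv hL, ← mul_apply_eq_comp,
      ← boundedCalc_mul hL hc (vanishesAtInfty_inv L), ← smul_apply, ← sub_apply,
      ← boundedCalc_const_mul hL _ hci, ← boundedCalc_sub hL hc
        (.bdd_mul continuousOn_const (fun _ _ => le_rfl) hci)]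
    congr 1
    refine boundedCalc_congr hL fun x hx => ?_
    have h1 : (Real.sqrt x : ℂ) * (Real.sqrt x : ℂ) = x := by
      rw [← Complex.ofReal_mul, Real.mul_self_sqrt (hS x hx)]
    have h2 := mul_inv_cancel₀ (ofReal_add_I_ne_zero x)
    simp only [hτ]
    linear_combination (-(cutoff n x : ℂ)) * h2 - (cutoff n x : ℂ) * ((x : ℂ) + Complex.I)⁻¹ * h1

end Hilbert

end SobolevOp

namespace SobolevOp

open OpCalc

variable {d : ℕ} {Ω : Set (EuclideanSpace ℝ (Fin d))}

/-! ### Assumption B -/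

/-- The pointwise sum of the absolute values of the dyadic pieces of `L^{-1/2} h`. -/
def dyadicMajorant (L : L2 Ω →ₗ.[ℂ] L2 Ω) (h : L2 Ω) (x : EuclideanSpace ℝ (Fin d)) : ℝ≥0∞ :=
  ∑' k : ℤ, ‖dyadicPiece L k h x‖ₑ

theorem aemeasurable_dyadicMajorant (L : L2 Ω →ₗ.[ℂ] L2 Ω) (h : L2 Ω) :
    AEMeasurable (dyadicMajorant L h) (volume.restrict Ω) :=
  AEMeasurable.tsum fun k => (Lp.aestronglyMeasurable (dyadicPiece L k h)).enorm

theorem enorm_sq_lintegral (f : L2 Ω) :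
    ∫⁻ x in Ω, ‖f x‖ₑ ^ (2 : ℝ) = ENNReal.ofReal (‖f‖ ^ 2) := by
  have h1 : (∫⁻ x in Ω, ‖f x‖ₑ ^ (2 : ℝ)) ^ (1 / (2 : ℝ)) = ENNReal.ofReal ‖f‖ := by
    rw [Lp.norm_def, ENNReal.ofReal_toReal (Lp.eLpNorm_ne_top f),
      eLpNorm_eq_lintegral_rpow_enorm_toReal (by norm_num) (by norm_num)]
    simp
  rw [ENNReal.ofReal_pow (norm_nonneg f), ← h1, ← ENNReal.rpow_natCast, ← ENNReal.rpow_mul]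
  norm_num

theorem ae_norm_dyadicPiece_le {L : L2 Ω →ₗ.[ℂ] L2 Ω} (hL : IsSelfAdjoint L)
    (hS : ∀ x ∈ realSpec L, 0 ≤ x) {C : ℝ} (hC : 0 < C)
    (hult : ∀ t : ℝ, 0 < t → ∀ f : L2 Ω, ∀ᵐ x ∂volume.restrict Ω,
      ‖boundedCalc L (fun x => (Real.exp (-t * x) : ℂ)) f x‖ ≤ C * t ^ (-((d : ℝ) / 4)) * ‖f‖)
    (h : L2 Ω) (k : ℤ) : ∀ᵐ x ∂volume.restrict Ω,
      ‖dyadicPiece L k h x‖ ≤ C * ‖h‖ * (2 : ℝ) ^ (-(((d : ℝ) / 4 - 1 / 2) * k)) := by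
  have ht : (0 : ℝ) < 2 ^ k := by positivity
  rw [dyadicPiece_apply hL hS]
  filter_upwards [hult _ ht (boundedCalc L (fun x => (invSqrtIncr ((2 : ℝ) ^ k) x : ℂ)) h)]
    with x hx
  refine hx.trans ?_
  have h1 := norm_boundedCalc_apply_le hL (Real.sqrt_nonneg ((2 : ℝ) ^ k))
    (φ := fun x => (invSqrtIncr ((2 : ℝ) ^ k) x : ℂ)) (fun x hx => by
      rw [Complex.norm_real, Real.norm_of_nonneg (invSqrtIncr_nonneg ht.le (hS x hx))]
      exact invSqrtIncr_le ht.le (hS x hx)) h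
  refine (mul_le_mul_of_nonneg_left h1 (by positivity)).trans_eq ?_
  rw [Real.sqrt_eq_rpow, ← Real.rpow_intCast, ← Real.rpow_mul (by norm_num),
    ← Real.rpow_mul (by norm_num)]
  have h2 : (2 : ℝ) ^ (-(((d : ℝ) / 4 - 1 / 2) * k)) =
      (2 : ℝ) ^ ((k : ℝ) * -((d : ℝ) / 4)) * (2 : ℝ) ^ ((k : ℝ) * (1 / 2)) := by
    rw [← Real.rpow_add (by norm_num)]
    ring_nf
  rw [h2]
  ring

theorem exists_lintegral_dyadicMajorant_le {L : L2 Ω →ₗ.[ℂ] L2 Ω} (hL : IsSelfAdjoint L)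
    (hS : ∀ x ∈ realSpec L, 0 ≤ x) (hd : 3 ≤ d) {C : ℝ} (hC : 0 < C)
    (hult : ∀ t : ℝ, 0 < t → ∀ f : L2 Ω, ∀ᵐ x ∂volume.restrict Ω,
      ‖boundedCalc L (fun x => (Real.exp (-t * x) : ℂ)) f x‖ ≤ C * t ^ (-((d : ℝ) / 4)) * ‖f‖) :
    ∃ C' : ℝ, 0 < C' ∧ ∀ h : L2 Ω,
      (∀ᵐ x ∂volume.restrict Ω, dyadicMajorant L h x < ∞) ∧
      (∫⁻ x in Ω, dyadicMajorant L h x ^ (2 * d / (d - 2) : ℝ)) ^ (1 / (2 * d / (d - 2) : ℝ)) ≤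
        ENNReal.ofReal (C' * ‖h‖) := by
  have hd' : (3 : ℝ) ≤ d := by exact_mod_cast hd
  have hd2 : (0 : ℝ) < d - 2 := by linarith
  have hd0 : (0 : ℝ) < d := by linarith
  set q : ℝ := 2 * d / (d - 2) with hq
  have hq0 : 0 < q := by positivity
  obtain ⟨C₂, hC₂, hsq⟩ := exists_sum_norm_sq_dyadicPiece_le
  obtain ⟨C₃, hC₃, hgeo⟩ := exists_sum_le_of_le_geometric (α := 1 / 2) (β := (d : ℝ) / 4 - 1 / 2)
    (by norm_num) (by linarith)
  have he1 : ((d : ℝ) / 4 - 1 / 2) / (1 / 2 + ((d : ℝ) / 4 - 1 / 2)) = 2 / q := by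
    rw [hq]; field_simp; ring
  have he2 : (1 / 2 : ℝ) / (1 / 2 + ((d : ℝ) / 4 - 1 / 2)) = 2 / d := by
    field_simp; ring
  have he3 : 2 / (d : ℝ) + 2 / q = 1 := by
    rw [hq]; field_simp; ring
  rw [he1, he2] at hgeo
  refine ⟨C₃ * C ^ (2 / (d : ℝ)) * C₂ ^ (1 / q), by positivity, fun h => ?_⟩
  set D : ℝ := C * ‖h‖ with hD
  have hD0 : 0 ≤ D := by positivity
  set A : EuclideanSpace ℝ (Fin d) → ℝ≥0∞ := fun x =>
    ∑' k : ℤ, ENNReal.ofReal ((2 : ℝ) ^ (-k)) * ‖dyadicPiece L k h x‖ₑ ^ (2 : ℝ) with hA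
  have hfm : ∀ k, AEMeasurable (fun x => ‖dyadicPiece L k h x‖ₑ ^ (2 : ℝ)) (volume.restrict Ω) :=
    fun k => (Lp.aestronglyMeasurable (dyadicPiece L k h)).enorm.pow_const _
  have hAm : AEMeasurable A (volume.restrict Ω) :=
    AEMeasurable.tsum fun k => (hfm k).const_mul _
  have hAint : ∫⁻ x in Ω, A x ≤ ENNReal.ofReal (C₂ * ‖h‖ ^ 2) := by
    rw [lintegral_tsum fun k => (hfm k).const_mul _]
    simp only [lintegral_const_mul'' _ (hfm _), enorm_sq_lintegral]
    rw [ENNReal.tsum_eq_iSup_sum]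
    refine iSup_le fun s => ?_
    refine le_trans (le_of_eq ?_) (ENNReal.ofReal_le_ofReal (hsq (L2 Ω) L hL hS h s))
    rw [ENNReal.ofReal_sum_of_nonneg fun k _ => by positivity]
    exact Finset.sum_congr rfl fun k _ => (ENNReal.ofReal_mul (by positivity)).symm
  have hAfin : ∀ᵐ x ∂volume.restrict Ω, A x < ∞ :=
    ae_lt_top' hAm (hAint.trans_lt ENNReal.ofReal_lt_top).ne
  have hb : ∀ᵐ x ∂volume.restrict Ω, ∀ k : ℤ,
      ‖dyadicPiece L k h x‖ ≤ D * (2 : ℝ) ^ (-(((d : ℝ) / 4 - 1 / 2) * k)) :=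
    ae_all_iff.mpr (ae_norm_dyadicPiece_le hL hS hC hult h)
  have hpt : ∀ᵐ x ∂volume.restrict Ω, A x < ∞ ∧ dyadicMajorant L h x ≤
      ENNReal.ofReal (C₃ * (Real.sqrt (A x).toReal ^ (2 / q) * D ^ (2 / (d : ℝ)))) := by
    filter_upwards [hAfin, hb] with x hx hxb
    refine ⟨hx, ?_⟩
    have h1 : ∀ k : ℤ, ‖dyadicPiece L k h x‖ ≤
        Real.sqrt (A x).toReal * (2 : ℝ) ^ ((1 / 2 : ℝ) * k) := by
      intro k
      have h2 : ENNReal.ofReal ((2 : ℝ) ^ (-k)) * ‖dyadicPiece L k h x‖ₑ ^ (2 : ℝ) ≤ A x :=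
        ENNReal.le_tsum (f := fun k : ℤ =>
          ENNReal.ofReal ((2 : ℝ) ^ (-k)) * ‖dyadicPiece L k h x‖ₑ ^ (2 : ℝ)) k
      have h3 := ENNReal.toReal_mono hx.ne h2
      rw [ENNReal.toReal_mul, ENNReal.toReal_ofReal (by positivity), ← ENNReal.toReal_rpow,
        toReal_enorm, zpow_neg, inv_mul_le_iff₀ (by positivity), Real.rpow_two] at h3
      have h4 : (2 : ℝ) ^ ((1 / 2 : ℝ) * k) = Real.sqrt (2 ^ k) := by
        rw [Real.sqrt_eq_rpow, ← Real.rpow_intCast, ← Real.rpow_mul (by norm_num), mul_comm]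
      rw [h4, mul_comm, ← Real.sqrt_mul (by positivity)]
      exact Real.le_sqrt_of_sq_le h3
    rw [dyadicMajorant, ENNReal.tsum_eq_iSup_sum]
    refine iSup_le fun s => ?_
    have h2 := hgeo _ D (fun k => ‖dyadicPiece L k h x‖) (Real.sqrt_nonneg _) hD0 h1 hxb s
    refine le_trans (le_of_eq ?_) (ENNReal.ofReal_le_ofReal h2)
    rw [ENNReal.ofReal_sum_of_nonneg fun k _ => norm_nonneg _]
    exact Finset.sum_congr rfl fun k _ => (ofReal_norm _).symm
  refine ⟨hpt.mono fun x hx => hx.2.trans_lt ENNReal.ofReal_lt_top, ?_⟩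
  have hint : ∫⁻ x in Ω, dyadicMajorant L h x ^ q ≤
      ENNReal.ofReal ((C₃ * D ^ (2 / (d : ℝ))) ^ q) * ENNReal.ofReal (C₂ * ‖h‖ ^ 2) := by
    refine le_trans ?_ (mul_le_mul_right hAint _)
    rw [← lintegral_const_mul'' _ hAm]
    refine lintegral_mono_ae ?_
    filter_upwards [hpt] with x hx
    refine (ENNReal.rpow_le_rpow hx.2 hq0.le).trans_eq ?_
    rw [ENNReal.ofReal_rpow_of_nonneg (by positivity) hq0.le]
    have h1 : (C₃ * (Real.sqrt (A x).toReal ^ (2 / q) * D ^ (2 / (d : ℝ)))) ^ q =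
        (C₃ * D ^ (2 / (d : ℝ))) ^ q * (A x).toReal := by
      rw [mul_left_comm, Real.mul_rpow (by positivity) (by positivity),
        ← Real.rpow_mul (by positivity), div_mul_cancel₀ _ hq0.ne', Real.rpow_two,
        Real.sq_sqrt ENNReal.toReal_nonneg, mul_comm]
    rw [h1, ENNReal.ofReal_mul (by positivity), ENNReal.ofReal_toReal hx.1.ne]
  refine (ENNReal.rpow_le_rpow hint (by positivity)).trans_eq ?_
  rw [← ENNReal.ofReal_mul (by positivity), ENNReal.ofReal_rpow_of_nonneg (by positivity)
    (by positivity)]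
  congr 1
  rw [Real.mul_rpow (by positivity) (by positivity), ← Real.rpow_mul (by positivity),
    mul_one_div_cancel hq0.ne', Real.rpow_one, hD, Real.mul_rpow hC.le (norm_nonneg h),
    Real.mul_rpow hC₂.le (by positivity), ← Real.rpow_natCast, ← Real.rpow_mul (norm_nonneg h)]
  have h1 : ‖h‖ ^ (2 / (d : ℝ)) * ‖h‖ ^ (((2 : ℕ) : ℝ) * (1 / q)) = ‖h‖ := by
    rw [← Real.rpow_add_of_nonneg (norm_nonneg h) (by positivity) (by positivity)]
    have : 2 / (d : ℝ) + ((2 : ℕ) : ℝ) * (1 / q) = 1 := by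
      push_cast
      linear_combination he3
    rw [this, Real.rpow_one]
  linear_combination C₃ * C ^ (2 / (d : ℝ)) * C₂ ^ (1 / q) * h1

theorem tendsto_Ico_neg : Tendsto (fun N : ℕ => Finset.Ico (-N : ℤ) N) atTop atTop := by
  refine tendsto_atTop_finset_of_monotone (fun a b hab => ?_) fun k => ⟨k.natAbs + 1, ?_⟩
  · exact Finset.Ico_subset_Ico (by omega) (by omega)
  · rw [Finset.mem_Ico]
    omega

theorem enorm_sum_dyadicPiece_le (L : L2 Ω →ₗ.[ℂ] L2 Ω) (h : L2 Ω)
    (s : Finset ℤ) (x : EuclideanSpace ℝ (Fin d)) :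
    ‖∑ k ∈ s, dyadicPiece L k h x‖ₑ ≤ dyadicMajorant L h x :=
  (enorm_sum_le _ _).trans (ENNReal.sum_le_tsum s)

theorem memLp_of_integrable_of_L2 (g : L2 Ω) (hg : Integrable g (volume.restrict Ω)) {r : ℝ}
    (h1 : 1 ≤ r) (h2 : r ≤ 2) : MemLp g (ENNReal.ofReal r) (volume.restrict Ω) := by
  have hr : 0 < r := by linarith
  refine ⟨Lp.aestronglyMeasurable g, ?_⟩
  refine (eLpNorm_lt_top_iff_lintegral_rpow_enorm_lt_top (by simpa using hr)
    ENNReal.ofReal_ne_top).mpr ?_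
  rw [ENNReal.toReal_ofReal hr.le]
  have h3 : ∀ y : ℝ≥0∞, y ^ r ≤ y + y ^ (2 : ℝ) := by
    intro y
    rcases le_total y 1 with hy | hy
    · refine le_add_right ?_
      simpa using ENNReal.rpow_le_rpow_of_exponent_ge hy h1
    · exact le_add_left (ENNReal.rpow_le_rpow_of_exponent_le hy h2)
  refine (lintegral_mono fun x => h3 _).trans_lt ?_
  rw [lintegral_add_left' (Lp.aestronglyMeasurable g).enorm, enorm_sq_lintegral]
  exact ENNReal.add_lt_top.mpr ⟨hg.2, ENNReal.ofReal_lt_top⟩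

theorem sobolev_of_assumptionB {L : L2 Ω →ₗ.[ℂ] L2 Ω} (hd : 3 ≤ d) (hB : AssumptionB L) :
    ∃ C : ℝ, 0 < C ∧
      (∀ (F : testSpace ℤ L →ₛₗ[starRingEnd ℂ] ℂ) (h : L2 Ω), MemHomH1 L F h →
        ∃ u : EuclideanSpace ℝ (Fin d) → ℂ,
          MemLp u (ENNReal.ofReal (2 * d / (d - 2))) (volume.restrict Ω) ∧ IsFunction F u ∧
          eLpNorm u (ENNReal.ofReal (2 * d / (d - 2))) (volume.restrict Ω) ≤
            ENNReal.ofReal (C * ‖h‖)) ∧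
      (∀ u h : L2 Ω, (u, h) ∈ (sqrtOp L).graph →
        MemLp u (ENNReal.ofReal (2 * d / (d - 2))) (volume.restrict Ω) ∧
        eLpNorm u (ENNReal.ofReal (2 * d / (d - 2))) (volume.restrict Ω) ≤
          ENNReal.ofReal (C * ‖h‖)) := by
  have hL := hB.1
  have hS := nonneg_of_mem_realSpec hL hB.2.1
  obtain ⟨C, hC, hult⟩ := hB.exists_ultracontractive hS
  obtain ⟨C', hC', hmaj⟩ := exists_lintegral_dyadicMajorant_le hL hS hd hC hult
  have hd' : (3 : ℝ) ≤ d := by exact_mod_cast hd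
  have hd2 : (0 : ℝ) < d - 2 := by linarith
  have hd0 : (0 : ℝ) < d := by linarith
  set q : ℝ := 2 * d / (d - 2) with hq
  have hq0 : 0 < q := by positivity
  have hq1 : ENNReal.ofReal q ≠ 0 := by simpa using hq0
  have hnorm : ∀ (h : L2 Ω) (u : EuclideanSpace ℝ (Fin d) → ℂ),
      (∀ᵐ x ∂volume.restrict Ω, ‖u x‖ₑ ≤ dyadicMajorant L h x) →
      eLpNorm u (ENNReal.ofReal q) (volume.restrict Ω) ≤ ENNReal.ofReal (C' * ‖h‖) := by
    intro h u hu
    refine le_trans ?_ (hmaj h).2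
    rw [eLpNorm_eq_lintegral_rpow_enorm_toReal hq1 ENNReal.ofReal_ne_top,
      ENNReal.toReal_ofReal hq0.le]
    refine ENNReal.rpow_le_rpow (lintegral_mono_ae ?_) (by positivity)
    filter_upwards [hu] with x hx
    exact ENNReal.rpow_le_rpow hx hq0.le
  have hcoe : ∀ (h : L2 Ω), ∀ᵐ x ∂volume.restrict Ω, ∀ N : ℕ,
      (∑ k ∈ Finset.Ico (-N : ℤ) N, dyadicPiece L k h : L2 Ω) x =
        ∑ k ∈ Finset.Ico (-N : ℤ) N, dyadicPiece L k h x := by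
    intro h
    refine ae_all_iff.mpr fun N => ?_
    filter_upwards [Lp.coeFn_finsetSum (Finset.Ico (-N : ℤ) N) fun k => dyadicPiece L k h]
      with x hx
    rw [hx, Finset.sum_apply]
  refine ⟨C', hC', fun F h hF => ?_, fun u h hu => ?_⟩
  · set u : EuclideanSpace ℝ (Fin d) → ℂ := fun x => ∑' k : ℤ, dyadicPiece L k h x with hu
    have hlim : ∀ᵐ x ∂volume.restrict Ω, Tendsto
        (fun N : ℕ => (∑ k ∈ Finset.Ico (-N : ℤ) N, dyadicPiece L k h : L2 Ω) x)
        atTop (𝓝 (u x)) := by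
      filter_upwards [(hmaj h).1, hcoe h] with x hx hxc
      simp only [hxc]
      have hs : Summable fun k : ℤ => dyadicPiece L k h x :=
        Summable.of_enorm hx.ne
      exact hs.hasSum.comp tendsto_Ico_neg
    have hpart : ∀ᵐ x ∂volume.restrict Ω, ∀ N : ℕ,
        ‖(∑ k ∈ Finset.Ico (-N : ℤ) N, dyadicPiece L k h : L2 Ω) x‖ₑ ≤ dyadicMajorant L h x := by
      filter_upwards [hcoe h] with x hx N
      rw [hx]
      exact enorm_sum_dyadicPiece_le L h _ x
    have hule : ∀ᵐ x ∂volume.restrict Ω, ‖u x‖ₑ ≤ dyadicMajorant L h x := by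
      filter_upwards [hlim, hpart] with x hx hxp
      exact le_of_tendsto hx.enorm (Eventually.of_forall hxp)
    have hum : AEStronglyMeasurable u (volume.restrict Ω) :=
      aestronglyMeasurable_of_tendsto_ae atTop (fun N => Lp.aestronglyMeasurable _) hlim
    have hun := hnorm h u hule
    refine ⟨u, ⟨hum, hun.trans_lt ENNReal.ofReal_lt_top⟩, fun g => ?_, hun⟩
    obtain ⟨v, hv0, hv⟩ := g.2
    have hg1 : Integrable (g : L2 Ω) (volume.restrict Ω) := by
      have := (hv 0).1
      rwa [hv0] at this
    have hgr : (v (-1), (g : L2 Ω)) ∈ L.graph := by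
      have := (hv (-1)).2
      rwa [neg_add_cancel, hv0] at this
    obtain ⟨w, hw1, hw2⟩ := exists_sqrtOp_graph hL hS hgr
    -- integrability of the majorant against the test function
    set r : ℝ := 2 * d / (d + 2) with hr
    have hr1 : 1 ≤ r := by rw [hr, one_le_div (by positivity)]; linarith
    have hr2 : r ≤ 2 := by rw [hr, div_le_iff₀ (by positivity)]; linarith
    have hgq := memLp_of_integrable_of_L2 (g : L2 Ω) hg1 hr1 hr2
    have hMm : MemLp (fun x => (dyadicMajorant L h x).toReal) (ENNReal.ofReal q)
        (volume.restrict Ω) := by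
      refine ⟨(aemeasurable_dyadicMajorant L h).ennreal_toReal.aestronglyMeasurable, ?_⟩
      rw [eLpNorm_eq_lintegral_rpow_enorm_toReal hq1 ENNReal.ofReal_ne_top,
        ENNReal.toReal_ofReal hq0.le]
      refine lt_of_le_of_lt ?_ ((hmaj h).2.trans_lt ENNReal.ofReal_lt_top)
      refine ENNReal.rpow_le_rpow (lintegral_mono fun x => ?_) (by positivity)
      refine ENNReal.rpow_le_rpow ?_ hq0.le
      rw [Real.enorm_of_nonneg ENNReal.toReal_nonneg]
      exact ENNReal.ofReal_toReal_le
    have hconj : Real.HolderConjugate q r := by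
      rw [Real.holderConjugate_iff]
      constructor
      · rw [hq, one_lt_div hd2]; linarith
      · rw [hq, hr]; field_simp; ring
    have : ENNReal.HolderConjugate (ENNReal.ofReal q) (ENNReal.ofReal r) := hconj.ennrealOfReal
    have hbound : Integrable (fun x => (dyadicMajorant L h x).toReal * ‖(g : L2 Ω) x‖)
        (volume.restrict Ω) := hMm.integrable_mul hgq.norm
    have hgm : AEStronglyMeasurable (fun x => conj ((g : L2 Ω) x)) (volume.restrict Ω) :=
      Complex.continuous_conj.comp_aestronglyMeasurable (Lp.aestronglyMeasurable _)
    have hdom : ∀ᵐ x ∂volume.restrict Ω, ∀ z : ℂ, ‖z‖ₑ ≤ dyadicMajorant L h x →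
        ‖z * conj ((g : L2 Ω) x)‖ ≤ (dyadicMajorant L h x).toReal * ‖(g : L2 Ω) x‖ := by
      filter_upwards [(hmaj h).1] with x hx z hz
      rw [norm_mul, RCLike.norm_conj]
      refine mul_le_mul_of_nonneg_right ?_ (norm_nonneg _)
      rw [← toReal_enorm]
      exact ENNReal.toReal_mono hx.ne hz
    refine ⟨hbound.mono' (hum.mul hgm) ?_, ?_⟩
    · filter_upwards [hdom, hule] with x hx hx2 using hx _ hx2
    · have h1 := tendsto_integral_of_dominated_convergence
        (F := fun (N : ℕ) x =>
          (∑ k ∈ Finset.Ico (-N : ℤ) N, dyadicPiece L k h : L2 Ω) x * conj ((g : L2 Ω) x))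
        (f := fun x => u x * conj ((g : L2 Ω) x))
        (μ := volume.restrict Ω) _ (fun N => (Lp.aestronglyMeasurable _).mul hgm) hbound
        (fun N => by filter_upwards [hdom, hpart] with x hx hx2 using hx _ (hx2 N))
        (by filter_upwards [hlim] with x hx using hx.mul_const _)
      refine tendsto_nhds_unique ?_ h1
      rw [hF.2 _ _ hw2, ← inner_eq_integral]
      have h2 : ∀ N : ℕ, ∫ x in Ω, (∑ k ∈ Finset.Ico (-N : ℤ) N, dyadicPiece L k h : L2 Ω) x *
          conj ((g : L2 Ω) x) =
          inner ℂ (boundedCalc L (fun x => (Real.exp (-((2 : ℝ) ^ (-N : ℤ)) * x) : ℂ)) w -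
            boundedCalc L (fun x => (Real.exp (-((2 : ℝ) ^ (N : ℤ)) * x) : ℂ)) w) h := by
        intro N
        rw [← inner_eq_integral, ← sum_dyadicPiece_apply hL hS hw2, inner_sum, sum_inner]
        exact Finset.sum_congr rfl fun k _ => (inner_boundedCalc_ofReal L _ _ _).symm
      simp only [h2]
      have h3 := ((tendsto_exp_apply_self hL hS w).sub (tendsto_exp_apply_zero hL hS hw1)).inner
        (tendsto_const_nhds (x := h)) (𝕜 := ℂ)
      rwa [sub_zero] at h3
  · have hle : ∀ᵐ x ∂volume.restrict Ω, ‖u x‖ₑ ≤ dyadicMajorant L h x := by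
      obtain ⟨ns, hns, hnslim⟩ := exists_seq_tendsto_ae_of_tendsto (tendsto_exp_apply_self hL hS u)
      have hbig : ∀ᵐ x ∂volume.restrict Ω, ∀ N : ℕ,
          ‖boundedCalc L (fun x => (Real.exp (-((2 : ℝ) ^ (N : ℤ)) * x) : ℂ)) u x‖ ≤
            C * ((2 : ℝ) ^ (N : ℤ)) ^ (-((d : ℝ) / 4)) * ‖u‖ :=
        ae_all_iff.mpr fun N => hult _ (by positivity) u
      have hsub : ∀ᵐ x ∂volume.restrict Ω, ∀ N : ℕ,
          (∑ k ∈ Finset.Ico (-N : ℤ) N, dyadicPiece L k h : L2 Ω) x =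
          boundedCalc L (fun x => (Real.exp (-((2 : ℝ) ^ (-N : ℤ)) * x) : ℂ)) u x -
            boundedCalc L (fun x => (Real.exp (-((2 : ℝ) ^ (N : ℤ)) * x) : ℂ)) u x := by
        refine ae_all_iff.mpr fun N => ?_
        rw [sum_dyadicPiece_apply hL hS hu]
        exact Lp.coeFn_sub _ _
      filter_upwards [hnslim, hbig, hsub, hcoe h] with x hx1 hx2 hx3 hx4
      have h1 : Tendsto (fun N : ℕ => C * ((2 : ℝ) ^ (N : ℤ)) ^ (-((d : ℝ) / 4)) * ‖u‖) atTop
          (𝓝 (C * 0 * ‖u‖)) := by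
        refine ((Tendsto.comp (tendsto_rpow_neg_atTop (by positivity)) ?_).const_mul C).mul_const _
        simpa only [zpow_natCast] using
          tendsto_pow_atTop_atTop_of_one_lt (r := (2 : ℝ)) (by norm_num)
      rw [mul_zero, zero_mul] at h1
      have h2 := (squeeze_zero_norm hx2 h1).comp hns.tendsto_atTop
      have h3 := hx1.sub h2
      rw [sub_zero] at h3
      refine le_of_tendsto h3.enorm (Eventually.of_forall fun i => ?_)
      have h4 := hx3 (ns i)
      rw [hx4] at h4
      rw [Function.comp_apply, ← h4]
      exact enorm_sum_dyadicPiece_le L h _ x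
    exact ⟨⟨Lp.aestronglyMeasurable u, (hnorm h u hle).trans_lt ENNReal.ofReal_lt_top⟩,
      hnorm h u hle⟩

end SobolevOp

end

theorem mainTheorem4 (d : ℕ) (hd : 1 ≤ d) (Ω : Set (EuclideanSpace ℝ (Fin d))) (hΩ : IsOpen Ω)
    (L : SobolevOp.L2 Ω →ₗ.[ℂ] SobolevOp.L2 Ω) :
    (SobolevOp.AssumptionA L →
      ∀ p : ℝ, 1 < p → (p : EReal) < SobolevOp.pStar d →
        ∃ C : ℝ, 0 < C ∧
          (∀ (F : SobolevOp.testSpace ℕ L →ₛₗ[starRingEnd ℂ] ℂ) (h : SobolevOp.L2 Ω),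
            SobolevOp.MemH1 L F h →
            ∃ u : EuclideanSpace ℝ (Fin d) → ℂ,
              MemLp u (ENNReal.ofReal (p + 1)) (volume.restrict Ω) ∧
              SobolevOp.IsFunction F u ∧
              eLpNorm u (ENNReal.ofReal (p + 1)) (volume.restrict Ω) ≤
                ENNReal.ofReal (C * ‖h‖)) ∧
          (∀ u h : SobolevOp.L2 Ω, (u, h) ∈ (OpCalc.sqrtOneAdd L).graph →
            MemLp u (ENNReal.ofReal (p + 1)) (volume.restrict Ω) ∧
            eLpNorm u (ENNReal.ofReal (p + 1)) (volume.restrict Ω) ≤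
              ENNReal.ofReal (C * ‖h‖))) ∧
    (3 ≤ d → SobolevOp.AssumptionB L →
        ∃ C : ℝ, 0 < C ∧
          (∀ (F : SobolevOp.testSpace ℤ L →ₛₗ[starRingEnd ℂ] ℂ) (h : SobolevOp.L2 Ω),
            SobolevOp.MemHomH1 L F h →
            ∃ u : EuclideanSpace ℝ (Fin d) → ℂ,
              MemLp u (ENNReal.ofReal (2 * d / (d - 2))) (volume.restrict Ω) ∧
              SobolevOp.IsFunction F u ∧
              eLpNorm u (ENNReal.ofReal (2 * d / (d - 2))) (volume.restrict Ω) ≤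
                ENNReal.ofReal (C * ‖h‖)) ∧
          (∀ u h : SobolevOp.L2 Ω, (u, h) ∈ (OpCalc.sqrtOp L).graph →
            MemLp u (ENNReal.ofReal (2 * d / (d - 2))) (volume.restrict Ω) ∧
            eLpNorm u (ENNReal.ofReal (2 * d / (d - 2))) (volume.restrict Ω) ≤
              ENNReal.ofReal (C * ‖h‖))) := by
  exact ⟨fun hA p hp hp' => SobolevOp.sobolev_of_assumptionA hA hp hp',
    fun hd3 hB => SobolevOp.sobolev_of_assumptionB hd3 hB⟩
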